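/- Let $r,s\ge 2$ be integers, $I_{r,s}=\{1,\dots,r\}\times\{1,\dots,s\}$, and let $p=(p_{ij})$ be a probability mass function (p.m.f.) on $I_{r,s}$ with $p_{ij}>0$ for all $(i,j)$. For an $r\times s$ matrix $x$ with nonnegative entries and positive row sums $x_{i+}$ and column sums $x_{+j}$, let $\mathcal U(x)$ denote the limit of the iterative proportional fitting procedure started at $x$ with uniform target margins, i.e. of alternately applying $x_{ij}\mapsto x_{ij}/(r\,x_{i+})$ and $x_{ij}\mapsto x_{ij}/(s\,x_{+j})$ (rows first). Let $u=\mathcal U(p)$ be the copula p.m.f. of $p$. Let $(X_k,Y_k)_{k\ge1}$ be $I_{r,s}$-valued random vectors and put $$\hat p^{[n]}_{ij}=\frac1n\sum_{k=1}^n\mathbf 1(X_k=i,Y_k=j),\qquad p^{[n]}_{ij}=\frac1{n+1}\Big\{\sum_{k=1}^n\mathbf 1(X_k=i,Y_k=j)+\frac1{rs}\Big\},\qquad u^{[n]}=\mathcal U(p^{[n]}).$$ For an $r\times s$ matrix $x$ define $$\Upsilon(x)=3\sqrt{\tfrac{(r-1)(s-1)}{(r+1)(s+1)}}\Big(\tfrac{4}{(r-1)(s-1)}\sum_{i,j}(i-1)(j-1)x_{ij}-1\Big),$$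 $$\kappa(x)=\sum_{(i-i')(j-j')>0}x_{ij}x_{i'j'},\quad \delta(x)=\sum_{(i-i')(j-j')<0}x_{ij}x_{i'j'},\quad G(x)=\frac{\kappa(x)-\delta(x)}{\kappa(x)+\delta(x)},$$ $$T(x)=\frac{\kappa(x)-\delta(x)}{\sqrt{\big(\sum_{i\ne i'}x_{i+}x_{i'+}\big)\big(\sum_{j\neq j'}x_{+j}x_{+j'}\big)}},$$ so that $\rho=\Upsilon(u)$, $\gamma=G(u)$, $\tau=T(u)$ are Yule's coefficient (the Pearson correlation under $u$), Goodman and Kruskal's gamma and Kendall's tau $b$; their estimators are $\rho^{[n]}=\Upsilon(u^{[n]})$, $\gamma^{[n]}=G(u^{[n]})$, $\tau^{[n]}=T(u^{[n]})$. Let $\mathrm{vec}$ be column-major vectorization and let $\dot\eta$ denote the gradient of $\eta$ with respect to the vectorized entries of its argument. Let $J_{u,p}=-K L_u^{-1}M_pN$, where, rows and columns being labelled in column-major order by the indicated pairs: - $K$ is the $rs\times(r-1)(s-1)$ matrix with $K\,\mathrm{vec}(z)=\mathrm{vec}\big(H_r\,z\,H_s^\top\big)$ for $z\in\mathbb R^{(r-1)\times(s-1)}$,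 where $H_m\in\mathbb R^{m\times(m-1)}$ is the identity matrix with a row of $-1$'s appended below; - $L_u$ is the $(r-1)(s-1)\times(r-1)(s-1)$ matrix with entry, at row $(k,l)$ and column $(i,j)$ ($k,i<r$; $l,j<s$), $$\frac{\mathbf 1(i=k,j=l)}{u_{kl}}+\frac{\mathbf 1(j=l)}{s^{-1}-\sum_{g<r}u_{gl}}+\frac{\mathbf 1(i=k)}{r^{-1}-\sum_{h<s}u_{kh}}+\frac1{r^{-1}+s^{-1}-1+\sum_{g<r,\,h<s}u_{gh}};$$ - $M_p$ is the $(r-1)(s-1)\times(rs-1)$ matrix with entry, at row $(k,l)$ ($k<r$, $l<s$) and column $(i,j)\in I_{r,s}\setminus\{(r,s)\}$, $$-\frac{\mathbf 1(i=k,j=l)}{p_{kl}}+\frac{\mathbf 1(i=r,j=l)}{p_{rl}}+\frac{\mathbf 1(i=k,j=s)}{p_{ks}}+\frac1{1-\sum_{(g,h)\ne(r,s)}p_{gh}};$$ - $N$ is the $(rs-1)\times rs$ matrix that drops the last coordinate. Let $\Sigma_p=\mathrm{diag}\{\mathrm{vec}(p)\}-\mathrm{vec}(p)\mathrm{vec}(p)^\top$.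 All limits are as $n\to\infty$. 1. If $\hat p^{[n]}\to p$ in probability, then $\rho^{[n]}\to\rho$, $\gamma^{[n]}\to\gamma$ and $\tau^{[n]}\to\tau$ in probability. 2. If, additionally, $\sqrt n(\hat p^{[n]}-p)$ converges in distribution to some random matrix $Z_p$, then $$\sqrt n(\rho^{[n]}-\rho)=\dot\Upsilon(u)^\top J_{u,p}\sqrt n\,\mathrm{vec}(\hat p^{[n]}-p)+o_P(1),$$ $$\sqrt n(\gamma^{[n]}-\gamma)=\dot G(u)^\top J_{u,p}\sqrt n\,\mathrm{vec}(\hat p^{[n]}-p)+o_P(1),$$ $$\sqrt n(\tau^{[n]}-\tau)=\dot T(u)^\top J_{u,p}\sqrt n\,\mathrm{vec}(\hat p^{[n]}-p)+o_P(1).$$ 3. If the $(X_k,Y_k)$ are independent with common p.m.f. $p$, then $\sqrt n(\rho^{[n]}-\rho)$, $\sqrt n(\gamma^{[n]}-\gamma)$ and $\sqrt n(\tau^{[n]}-\tau)$ converge in distribution to centered normal laws (a point mass at $0$ if the variance is $0$) with variances $\dot\Upsilon(u)^\top J_{u,p}\Sigma_pJ_{u,p}^\top\dot\Upsilon(u)$,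 $\dot G(u)^\top J_{u,p}\Sigma_pJ_{u,p}^\top\dot G(u)$ and $\dot T(u)^\top J_{u,p}\Sigma_pJ_{u,p}^\top\dot T(u)$, respectively. -/

import Mathlib

open MeasureTheory ProbabilityTheory Filter Topology

noncomputable section

namespace CopulaPmf

/-- Real `r × s` tables (matrices), with the product topology and product sigma-algebra.
The labels `1, …, r` of the paper are the elements `0, …, r - 1` of `Fin r`. -/
abbrev Table (r s : ℕ) : Type := Fin r → Fin s → ℝ

section Ipfp

variable {r s : ℕ}

/-- Row sums `x_{i+}`, the first univariate margin. -/
def rowSum (x : Table r s) (i : Fin r) : ℝ := ∑ j, x i j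

/-- Column sums `x_{+j}`, the second univariate margin. -/
def colSum (x : Table r s) (j : Fin s) : ℝ := ∑ i, x i j

/-- Bivariate probability mass functions with strictly positive univariate margins. -/
def Gamma (r s : ℕ) : Set (Table r s) :=
  {x | (∀ i j, 0 ≤ x i j) ∧ (∀ i, 0 < rowSum x i) ∧ (∀ j, 0 < colSum x j) ∧
    ∑ i, ∑ j, x i j = 1}

/-- Support of a table. -/
def supp (x : Table r s) : Set (Fin r × Fin s) := {q | 0 < x q.1 q.2}

/-- Rescaling of the rows of `x`, so that its row sums become `a`. -/
def rowScale (a : Fin r → ℝ) (x : Table r s) : Table r s :=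
  fun i j => a i * x i j / rowSum x i

/-- Rescaling of the columns of `x`, so that its column sums become `b`. -/
def colScale (b : Fin s → ℝ) (x : Table r s) : Table r s :=
  fun i j => b j * x i j / colSum x j

/-- The `N`-th step of the iterative proportional fitting procedure with target margins `a` and
`b`: alternate row and column scalings, starting with the rows. -/
def ipfpStep (a : Fin r → ℝ) (b : Fin s → ℝ) (N : ℕ) (x : Table r s) : Table r s :=
  if N % 2 = 1 then rowScale a ((colScale b ∘ rowScale a)^[N / 2] x)
  else (colScale b ∘ rowScale a)^[N / 2] x

/-- The limit of the iterative proportional fitting procedure (where it exists; it does for every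
table with strictly positive entries and strictly positive target p.m.f.s). -/
def ipfp (a : Fin r → ℝ) (b : Fin s → ℝ) (x : Table r s) : Table r s :=
  limUnder atTop (fun N : ℕ => ipfpStep a b N x)

/-- The copula p.m.f. of `x`: the limit of the procedure with uniform target margins. -/
def copula (x : Table r s) : Table r s :=
  ipfp (fun _ => 1 / (r : ℝ)) (fun _ => 1 / (s : ℝ)) x

end Ipfp

section Coefficients

variable {r s : ℕ}

/-- Yule's coefficient. As `Fin` counts from `0`, the casts `(i : ℝ)` and `(j : ℝ)` are the paper's
labels minus one. On p.m.f.s with uniform margins this is Pearson's linear correlation. -/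
def yule (x : Table r s) : ℝ :=
  3 * √((((r : ℝ) - 1) * ((s : ℝ) - 1)) / (((r : ℝ) + 1) * ((s : ℝ) + 1))) *
    (4 / (((r : ℝ) - 1) * ((s : ℝ) - 1)) *
      (∑ i : Fin r, ∑ j : Fin s, ((i : ℕ) : ℝ) * ((j : ℕ) : ℝ) * x i j) - 1)

/-- Probability of concordance of two independent pairs with p.m.f. `x`. -/
def concord (x : Table r s) : ℝ :=
  ∑ i : Fin r, ∑ j : Fin s, ∑ i' : Fin r, ∑ j' : Fin s,
    if 0 < (((i : ℕ) : ℤ) - ((i' : ℕ) : ℤ)) * (((j : ℕ) : ℤ) - ((j' : ℕ) : ℤ))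
    then x i j * x i' j' else 0

/-- Probability of discordance of two independent pairs with p.m.f. `x`. -/
def discord (x : Table r s) : ℝ :=
  ∑ i : Fin r, ∑ j : Fin s, ∑ i' : Fin r, ∑ j' : Fin s,
    if (((i : ℕ) : ℤ) - ((i' : ℕ) : ℤ)) * (((j : ℕ) : ℤ) - ((j' : ℕ) : ℤ)) < 0
    then x i j * x i' j' else 0

/-- `Pr(U ≠ U')` for two independent pairs `(U, V)`, `(U', V')` with p.m.f. `x`. -/
def neqRow (x : Table r s) : ℝ :=
  ∑ i : Fin r, ∑ i' : Fin r, if i ≠ i' then rowSum x i * rowSum x i' else 0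

/-- `Pr(V ≠ V')` for two independent pairs `(U, V)`, `(U', V')` with p.m.f. `x`. -/
def neqCol (x : Table r s) : ℝ :=
  ∑ j : Fin s, ∑ j' : Fin s, if j ≠ j' then colSum x j * colSum x j' else 0

/-- Goodman and Kruskal's gamma. -/
def gkGamma (x : Table r s) : ℝ :=
  (concord x - discord x) / (concord x + discord x)

/-- Kendall's tau b. -/
def tauB (x : Table r s) : ℝ :=
  (concord x - discord x) / √(neqRow x * neqCol x)

/-- Vectorization of a table. The coordinates of a vector of `ℝ^{rs}` are labelled by the cells
`(i, j)` themselves. -/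
def vec (x : Table r s) : Fin r × Fin s → ℝ := fun q => x q.1 q.2

/-- The table with entry `1` in the cell `q` and `0` elsewhere. -/
def unitTable (q : Fin r × Fin s) : Table r s := fun i j => if (i, j) = q then 1 else 0

/-- The (vectorized) gradient: the vector of the partial derivatives with respect to the `rs`
entries of the table. -/
def grad (η : Table r s → ℝ) (x : Table r s) : Fin r × Fin s → ℝ :=
  fun q => lineDeriv ℝ η x (unitTable q)

end Coefficients

section Jacobian

variable {r s : ℕ}

/-- The last label, `r` in `I_r`. -/
def lastIdx (r : ℕ) [NeZero r] : Fin r := ⟨r - 1, Nat.sub_one_lt (NeZero.ne r)⟩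

/-- The inclusion of `I_{r-1}` in `I_r`. -/
def low (k : Fin (r - 1)) : Fin r := Fin.castLE (Nat.sub_le r 1) k

/-- The cells of the table other than the last one `(r, s)`. -/
abbrev FreeCell (r s : ℕ) [NeZero r] [NeZero s] : Type :=
  {q : Fin r × Fin s // q ≠ (lastIdx r, lastIdx s)}

/-- The `r × (r - 1)` matrix `H`: the identity on top of a row of `-1`. -/
def matH (r : ℕ) : Matrix (Fin r) (Fin (r - 1)) ℝ :=
  Matrix.of fun i k => if (i : ℕ) = (k : ℕ) then 1 else if (i : ℕ) = r - 1 then -1 else 0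

/-- The `rs × (r - 1)(s - 1)` block matrix `K`: block rows are indexed by columns `j` of the table,
block columns by `l`; the block `(j, l)` is `H` if `j = l`, `-H` if `j` is the last label, and `0`
otherwise. -/
def matK (r s : ℕ) : Matrix (Fin r × Fin s) (Fin (r - 1) × Fin (s - 1)) ℝ :=
  Matrix.of fun q t =>
    if (q.2 : ℕ) = (t.2 : ℕ) then matH r q.1 t.1
    else if (q.2 : ℕ) = s - 1 then -matH r q.1 t.1 else 0

/-- The matrix `L_u`, of size `(r - 1)(s - 1)`; row `(k, l)`, column `(i, j)`. -/
def matL (u : Table r s) :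
    Matrix (Fin (r - 1) × Fin (s - 1)) (Fin (r - 1) × Fin (s - 1)) ℝ :=
  Matrix.of fun (k, l) (i, j) =>
    (if i = k ∧ j = l then 1 else 0) / u (low k) (low l)
      + (if j = l then 1 else 0) / (1 / (s : ℝ) - ∑ g : Fin (r - 1), u (low g) (low l))
      + (if i = k then 1 else 0) / (1 / (r : ℝ) - ∑ h : Fin (s - 1), u (low k) (low h))
      + 1 / (1 / (r : ℝ) + 1 / (s : ℝ) - 1
          + ∑ g : Fin (r - 1), ∑ h : Fin (s - 1), u (low g) (low h))

variable [NeZero r] [NeZero s]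

/-- The `(r - 1)(s - 1) × (rs - 1)` matrix `M_p`; row `(k, l)`, column `(i, j) ≠ (r, s)`. -/
def matM (p : Table r s) : Matrix (Fin (r - 1) × Fin (s - 1)) (FreeCell r s) ℝ :=
  Matrix.of fun (k, l) q =>
    -((if q.1 = (low k, low l) then 1 else 0) / p (low k) (low l))
      + (if q.1 = (lastIdx r, low l) then 1 else 0) / p (lastIdx r) (low l)
      + (if q.1 = (low k, lastIdx s) then 1 else 0) / p (low k) (lastIdx s)
      + 1 / (1 - ∑ q' : FreeCell r s, p q'.1.1 q'.1.2)

/-- The `(rs - 1) × rs` matrix `N`, which drops the coordinate of the last cell. -/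
def matN (r s : ℕ) [NeZero r] [NeZero s] : Matrix (FreeCell r s) (Fin r × Fin s) ℝ :=
  Matrix.of fun q q' => if q.1 = q' then 1 else 0

/-- The `rs × rs` matrix `J_{u,p} = - K L_u⁻¹ M_p N`. -/
def matJ (u p : Table r s) : Matrix (Fin r × Fin s) (Fin r × Fin s) ℝ :=
  -(matK r s * (matL u)⁻¹ * matM p * matN r s)

/-- The covariance matrix `Σ_p = diag(vec p) - (vec p)(vec p)ᵀ`. -/
def covMat (p : Table r s) : Matrix (Fin r × Fin s) (Fin r × Fin s) ℝ :=
  Matrix.diagonal (vec p) - Matrix.vecMulVec (vec p) (vec p)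

end Jacobian

section Estimators

variable {Ω : Type*} {r s : ℕ}

/-- Number of observations among the first `n` that fall in the cell `(i, j)`. -/
def cellCount (X : ℕ → Ω → Fin r) (Y : ℕ → Ω → Fin s) (n : ℕ) (ω : Ω) (i : Fin r) (j : Fin s) :
    ℝ :=
  ∑ k ∈ Finset.range n, if X k ω = i ∧ Y k ω = j then 1 else 0

/-- The empirical p.m.f. of the first `n` observations. -/
def pHat (X : ℕ → Ω → Fin r) (Y : ℕ → Ω → Fin s) (n : ℕ) (ω : Ω) : Table r s :=
  fun i j => 1 / (n : ℝ) * cellCount X Y n ω i j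

/-- The smoothed empirical p.m.f. of the first `n` observations. -/
def pSmooth (X : ℕ → Ω → Fin r) (Y : ℕ → Ω → Fin s) (n : ℕ) (ω : Ω) : Table r s :=
  fun i j => 1 / ((n : ℝ) + 1) * (cellCount X Y n ω i j + 1 / ((r : ℝ) * (s : ℝ)))

/-- The empirical copula p.m.f. -/
def uHat (X : ℕ → Ω → Fin r) (Y : ℕ → Ω → Fin s) (n : ℕ) (ω : Ω) : Table r s :=
  copula (pSmooth X Y n ω)

variable [MeasurableSpace Ω] [NeZero r] [NeZero s]

/-- Consistency of the plug-in estimator of `η` at the copula p.m.f. of `p`. -/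
def Consistent (P : Measure Ω) (X : ℕ → Ω → Fin r) (Y : ℕ → Ω → Fin s) (p : Table r s)
    (η : Table r s → ℝ) : Prop :=
  TendstoInMeasure P (fun n ω => η (uHat X Y n ω)) atTop (fun _ => η (copula p))

/-- Asymptotic linearity of the plug-in estimator of `η`:
`√n (η(u^n) - η(u)) - ∇η(u)ᵀ J_{u,p} √n vec(p̂^n - p)` tends to zero in probability. -/
def AsympLinear (P : Measure Ω) (X : ℕ → Ω → Fin r) (Y : ℕ → Ω → Fin s) (p : Table r s)
    (η : Table r s → ℝ) : Prop :=
  TendstoInMeasure P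
    (fun (n : ℕ) ω => √(n : ℝ) * (η (uHat X Y n ω) - η (copula p))
      - grad η (copula p) ⬝ᵥ
          (matJ (copula p) p).mulVec (√(n : ℝ) • vec (pHat X Y n ω - p)))
    atTop (fun _ => 0)

/-- The asymptotic variance `∇η(u)ᵀ J_{u,p} Σ_p J_{u,p}ᵀ ∇η(u)`, where `u` is the copula p.m.f. of
`p`. -/
def asympVar (p : Table r s) (η : Table r s → ℝ) : ℝ :=
  grad η (copula p) ⬝ᵥ
    (matJ (copula p) p * covMat p * (matJ (copula p) p).transpose).mulVec (grad η (copula p))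

/-- Asymptotic centered normality of the plug-in estimator of `η`: the variance above is a
nonnegative number `v` and `√n (η(u^n) - η(u))` converges in distribution to `𝒩(0, v)`. -/
def AsympNormal (P : Measure Ω) [IsProbabilityMeasure P] (X : ℕ → Ω → Fin r) (Y : ℕ → Ω → Fin s)
    (p : Table r s) (η : Table r s → ℝ) : Prop :=
  ∃ v : NNReal, (v : ℝ) = asympVar p η ∧
    TendstoInDistribution (fun (n : ℕ) ω => √(n : ℝ) * (η (uHat X Y n ω) - η (copula p))) atTop
      (id : ℝ → ℝ) (fun _ => P) (gaussianReal 0 v)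

end Estimators

end CopulaPmf

end

/-! The three statements are the delta method applied to `η ∘ copula`, with `η` one of the
coefficients; the substance is that `copula` is well defined and differentiable at a positive
p.m.f., with derivative `J_{u,p}` in the directions that matter.

Row and column scalings preserve the odds ratios, and a positive table is determined by its margins
and odds ratios (`eq_of_margins_of_logOdds`). With uniform targets and total mass one, each scaling
does not decrease the sum of the log entries, and leaves it unchanged only if the scaled margin is
already uniform. This Lyapunov function also keeps the iterates in a compact set of positive tables,
so every cluster point is the unique positive table with uniform margins and the odds ratios of the
start (`exists_tendsto_iterate_unifRound`).

Tables with uniform margins near `u` are `u + K z`. In the coordinate `z` the log odds ratios have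
derivative `L_u` at `0`, which is invertible because of the positive form `∑ w² / u`. The inverse
function theorem then writes the copula map locally as log odds ratios followed by a smooth inverse
(`hasFDerivAt_copula`). On tables of total mass zero the derivative is `J_{u,p}` (`matJ_mulVec`).

Smoothing moves the empirical p.m.f. by at most `1 / (n + 1)`, negligible at scale `√n`
(`delta_method_perturbed`). After linearization only a scalar central limit theorem for a linear
functional of the empirical p.m.f. is needed. -/

namespace CopulaPmf

/-! ### Scalings, odds ratios and uniqueness of the copula table. -/

section Scaling

variable {r s : ℕ}

lemma rowSum_pos [NeZero s] {x : Table r s} (hx : ∀ i j, 0 < x i j) (i : Fin r) :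
    0 < rowSum x i :=
  Finset.sum_pos (fun j _ => hx i j) Finset.univ_nonempty

lemma colSum_pos [NeZero r] {x : Table r s} (hx : ∀ i j, 0 < x i j) (j : Fin s) :
    0 < colSum x j :=
  Finset.sum_pos (fun i _ => hx i j) Finset.univ_nonempty

lemma sum_rowSum (x : Table r s) : ∑ i, rowSum x i = ∑ i, ∑ j, x i j := rfl

lemma sum_colSum (x : Table r s) : ∑ j, colSum x j = ∑ i, ∑ j, x i j := Finset.sum_comm

lemma continuous_entry (i : Fin r) (j : Fin s) : Continuous fun x : Table r s => x i j :=
  continuous_apply_apply i j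

lemma continuous_rowSum (i : Fin r) : Continuous fun x : Table r s => rowSum x i := by
  unfold rowSum; fun_prop

lemma continuous_colSum (j : Fin s) : Continuous fun x : Table r s => colSum x j := by
  unfold colSum; fun_prop

lemma rowScale_pos [NeZero s] {a : Fin r → ℝ} (ha : ∀ i, 0 < a i) {x : Table r s}
    (hx : ∀ i j, 0 < x i j) (i : Fin r) (j : Fin s) : 0 < rowScale a x i j :=
  div_pos (mul_pos (ha i) (hx i j)) (rowSum_pos hx i)

lemma colScale_pos [NeZero r] {b : Fin s → ℝ} (hb : ∀ j, 0 < b j) {x : Table r s}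
    (hx : ∀ i j, 0 < x i j) (i : Fin r) (j : Fin s) : 0 < colScale b x i j :=
  div_pos (mul_pos (hb j) (hx i j)) (colSum_pos hx j)

lemma rowSum_rowScale [NeZero s] (a : Fin r → ℝ) {x : Table r s} (hx : ∀ i j, 0 < x i j)
    (i : Fin r) : rowSum (rowScale a x) i = a i := by
  have h := (rowSum_pos hx i).ne'
  unfold rowScale
  rw [rowSum, ← Finset.sum_div, ← Finset.mul_sum]
  exact mul_div_cancel_right₀ _ h

lemma colSum_colScale [NeZero r] (b : Fin s → ℝ) {x : Table r s} (hx : ∀ i j, 0 < x i j)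
    (j : Fin s) : colSum (colScale b x) j = b j :=
  rowSum_rowScale (x := fun j i => x i j) b (fun j i => hx i j) j

lemma rowScale_eq_self [NeZero s] {a : Fin r → ℝ} {x : Table r s} (hx : ∀ i j, 0 < x i j)
    (h : ∀ i, rowSum x i = a i) : rowScale a x = x := by
  funext i j
  have h1 := (rowSum_pos hx i).ne'
  rw [rowScale, ← h i, mul_div_cancel_left₀ _ h1]

lemma continuousAt_rowScale [NeZero s] (a : Fin r → ℝ) {x : Table r s} (hx : ∀ i j, 0 < x i j) :
    ContinuousAt (rowScale a) x := by
  refine continuousAt_pi.2 fun i => continuousAt_pi.2 fun j => ?_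
  unfold rowScale
  exact ContinuousAt.div ((continuous_entry i j).const_mul _).continuousAt
    (continuous_rowSum i).continuousAt (rowSum_pos hx i).ne'

lemma continuousAt_colScale [NeZero r] (b : Fin s → ℝ) {x : Table r s} (hx : ∀ i j, 0 < x i j) :
    ContinuousAt (colScale b) x := by
  refine continuousAt_pi.2 fun i => continuousAt_pi.2 fun j => ?_
  unfold colScale
  exact ContinuousAt.div ((continuous_entry i j).const_mul _).continuousAt
    (continuous_colSum j).continuousAt (colSum_pos hx j).ne'

/-- The log odds ratio of the cell `(i, j)` relative to the cell `(i₀, j₀)`. -/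
noncomputable def logOdds (i₀ : Fin r) (j₀ : Fin s) (x : Table r s) (i : Fin r) (j : Fin s) : ℝ :=
  Real.log (x i j) - Real.log (x i j₀) - Real.log (x i₀ j) + Real.log (x i₀ j₀)

lemma continuousAt_logOdds (i₀ : Fin r) (j₀ : Fin s) {x : Table r s} (hx : ∀ i j, 0 < x i j) :
    ContinuousAt (logOdds i₀ j₀) x := by
  have h (i : Fin r) (j : Fin s) : ContinuousAt (fun y : Table r s => Real.log (y i j)) x :=
    ContinuousAt.log (continuous_entry i j).continuousAt (hx i j).ne'
  refine continuousAt_pi.2 fun i => continuousAt_pi.2 fun j => ?_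
  exact (((h i j).sub (h i j₀)).sub (h i₀ j)).add (h i₀ j₀)

lemma log_rowScale [NeZero s] {a : Fin r → ℝ} (ha : ∀ i, 0 < a i) {x : Table r s}
    (hx : ∀ i j, 0 < x i j) (i : Fin r) (j : Fin s) :
    Real.log (rowScale a x i j) = Real.log (x i j) - Real.log (rowSum x i / a i) := by
  have h := rowSum_pos hx i
  rw [rowScale, ← Real.log_div (hx i j).ne' (div_pos h (ha i)).ne']
  congr 1
  have := (ha i).ne'
  field_simp

lemma log_colScale [NeZero r] {b : Fin s → ℝ} (hb : ∀ j, 0 < b j) {x : Table r s}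
    (hx : ∀ i j, 0 < x i j) (i : Fin r) (j : Fin s) :
    Real.log (colScale b x i j) = Real.log (x i j) - Real.log (colSum x j / b j) :=
  log_rowScale (x := fun j i => x i j) hb (fun j i => hx i j) j i

lemma logOdds_rowScale [NeZero s] (i₀ : Fin r) (j₀ : Fin s) {a : Fin r → ℝ} (ha : ∀ i, 0 < a i)
    {x : Table r s} (hx : ∀ i j, 0 < x i j) :
    logOdds i₀ j₀ (rowScale a x) = logOdds i₀ j₀ x := by
  funext i j
  simp only [logOdds, log_rowScale ha hx]
  ring

lemma logOdds_colScale [NeZero r] (i₀ : Fin r) (j₀ : Fin s) {b : Fin s → ℝ} (hb : ∀ j, 0 < b j)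
    {x : Table r s} (hx : ∀ i j, 0 < x i j) :
    logOdds i₀ j₀ (colScale b x) = logOdds i₀ j₀ x := by
  funext i j
  simp only [logOdds, log_colScale hb hx]
  ring

/-- Tables with vanishing margins are orthogonal to additive tables. -/
lemma sum_mul_eq_zero_of_additive {w e : Table r s} (i₀ : Fin r) (j₀ : Fin s)
    (hrow : ∀ i, rowSum w i = 0) (hcol : ∀ j, colSum w j = 0)
    (he : ∀ i j, e i j - e i j₀ - e i₀ j + e i₀ j₀ = 0) :
    ∑ i, ∑ j, w i j * e i j = 0 := by
  -- Additivity splits `e i j` into a function of `i` plus a function of `j`; each meets only a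
  -- margin of `w`.
  have h1 : ∑ i, ∑ j, w i j * e i j
      = ∑ i, (∑ j, w i j) * (e i j₀ - e i₀ j₀) + ∑ j, (∑ i, w i j) * e i₀ j := by
    simp only [Finset.sum_mul]
    rw [Finset.sum_comm (s := (Finset.univ : Finset (Fin s))), ← Finset.sum_add_distrib]
    refine Finset.sum_congr rfl fun i _ => ?_
    rw [← Finset.sum_add_distrib]
    refine Finset.sum_congr rfl fun j _ => ?_
    linear_combination w i j * he i j
  rw [h1]
  simp only [rowSum, colSum] at hrow hcol
  simp [hrow, hcol]

/-- A positive table is determined by its margins and its odds ratios. -/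
lemma eq_of_margins_of_logOdds {u v : Table r s} (hu : ∀ i j, 0 < u i j) (hv : ∀ i j, 0 < v i j)
    (hrow : ∀ i, rowSum u i = rowSum v i) (hcol : ∀ j, colSum u j = colSum v j)
    (i₀ : Fin r) (j₀ : Fin s) (h : logOdds i₀ j₀ u = logOdds i₀ j₀ v) : u = v := by
  -- Equal odds ratios make `log u - log v` additive and equal margins make `u - v` margin-free.
  -- Their inner product is zero, yet each term is nonnegative since `log` is increasing.
  have hsum := sum_mul_eq_zero_of_additive (w := fun i j => u i j - v i j)
    (e := fun i j => Real.log (u i j) - Real.log (v i j)) i₀ j₀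
    (fun i => by have := hrow i; simp only [rowSum] at this; simp [rowSum, this])
    (fun j => by have := hcol j; simp only [colSum] at this; simp [colSum, this])
    (fun i j => by
      have := congrFun (congrFun h i) j
      simp only [logOdds] at this
      linear_combination this)
  have hnn (i : Fin r) (j : Fin s) :
      0 ≤ (u i j - v i j) * (Real.log (u i j) - Real.log (v i j)) := by
    rcases le_total (u i j) (v i j) with hle | hle
    · exact mul_nonneg_of_nonpos_of_nonpos (sub_nonpos.2 hle)
        (sub_nonpos.2 (Real.log_le_log (hu i j) hle))
    · exact mul_nonneg (sub_nonneg.2 hle) (sub_nonneg.2 (Real.log_le_log (hv i j) hle))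
  rw [Finset.sum_eq_zero_iff_of_nonneg fun i _ => Finset.sum_nonneg fun j _ => hnn i j] at hsum
  funext i j
  have h1 := hsum i (Finset.mem_univ i)
  rw [Finset.sum_eq_zero_iff_of_nonneg fun j _ => hnn i j] at h1
  rcases mul_eq_zero.1 (h1 j (Finset.mem_univ j)) with h2 | h2
  · exact sub_eq_zero.1 h2
  · exact Real.log_injOn_pos (hu i j) (hv i j) (sub_eq_zero.1 h2)

lemma le_one_of_sum_eq_one {x : Table r s} (hx : ∀ i j, 0 < x i j) (h1 : ∑ i, ∑ j, x i j = 1)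
    (i : Fin r) (j : Fin s) : x i j ≤ 1 :=
  calc x i j ≤ ∑ j, x i j :=
        Finset.single_le_sum (fun j _ => (hx i j).le) (Finset.mem_univ j)
    _ ≤ ∑ i, ∑ j, x i j :=
        Finset.single_le_sum (f := fun i => ∑ j, x i j)
          (fun i _ => Finset.sum_nonneg fun j _ => (hx i j).le) (Finset.mem_univ i)
    _ = 1 := h1

/-- The sum of the logarithms of the entries, which the scalings with uniform target margins
increase. -/
noncomputable def logSum (x : Table r s) : ℝ := ∑ i, ∑ j, Real.log (x i j)

lemma continuousAt_logSum {x : Table r s} (hx : ∀ i j, 0 < x i j) : ContinuousAt logSum x := by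
  unfold logSum
  refine tendsto_finsetSum _ fun i _ => tendsto_finsetSum _ fun j _ => ?_
  exact ContinuousAt.log (continuous_entry i j).continuousAt (hx i j).ne'

/-- All the logarithms are nonpositive, so discarding terms can only increase the sum. A lower bound
on `logSum` thus keeps every entry away from zero. -/
lemma logSum_le_log {x : Table r s} (hx : ∀ i j, 0 < x i j) (h1 : ∑ i, ∑ j, x i j = 1)
    (i : Fin r) (j : Fin s) : logSum x ≤ Real.log (x i j) := by
  have hn (i : Fin r) (j : Fin s) : 0 ≤ -Real.log (x i j) :=
    neg_nonneg.2 (Real.log_nonpos (hx i j).le (le_one_of_sum_eq_one hx h1 i j))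
  have : -Real.log (x i j) ≤ -logSum x :=
    calc -Real.log (x i j) ≤ ∑ j, -Real.log (x i j) :=
          Finset.single_le_sum (fun j _ => hn i j) (Finset.mem_univ j)
      _ ≤ ∑ i, ∑ j, -Real.log (x i j) :=
          Finset.single_le_sum (f := fun i => ∑ j, -Real.log (x i j))
            (fun i _ => Finset.sum_nonneg fun j _ => hn i j) (Finset.mem_univ i)
      _ = -logSum x := by simp [logSum]
  linarith

end Scaling

/-! ### The inequality `log t ≤ t - 1` and its equality case, summed. -/

section LogSum

variable {ι : Type*} [Fintype ι] {t : ι → ℝ}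

lemma sum_log_nonpos (ht : ∀ i, 0 < t i) (hsum : ∑ i, (t i - 1) = 0) :
    ∑ i, Real.log (t i) ≤ 0 :=
  hsum ▸ Finset.sum_le_sum fun i _ => Real.log_le_sub_one_of_pos (ht i)

lemma eq_one_of_sum_log_eq_zero (ht : ∀ i, 0 < t i) (hsum : ∑ i, (t i - 1) = 0)
    (h : ∑ i, Real.log (t i) = 0) (i : ι) : t i = 1 := by
  have h1 := (Finset.sum_eq_sum_iff_of_le
    fun i _ => Real.log_le_sub_one_of_pos (ht i)).1 (h.trans hsum.symm) i (Finset.mem_univ i)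
  by_contra hne
  exact (Real.log_lt_sub_one_of_pos (ht i) hne).ne h1

end LogSum

/-! ### Convergence of iterative proportional fitting. -/

section Convergence

variable {r s : ℕ} [NeZero r] [NeZero s]

lemma unif_pos (n : ℕ) [NeZero n] : (0 : ℝ) < 1 / n :=
  one_div_pos.2 (Nat.cast_pos.2 (NeZero.pos n))

lemma logSum_rowScale {x : Table r s} (hx : ∀ i j, 0 < x i j) :
    logSum (rowScale (fun _ => 1 / (r : ℝ)) x)
      = logSum x - s * ∑ i, Real.log (rowSum x i / (1 / (r : ℝ))) := by
  simp only [logSum, log_rowScale (fun _ => unif_pos r) hx, Finset.sum_sub_distrib,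
    Finset.sum_const, Finset.card_univ, Fintype.card_fin, nsmul_eq_mul, Finset.mul_sum]

lemma logSum_colScale {x : Table r s} (hx : ∀ i j, 0 < x i j) :
    logSum (colScale (fun _ => 1 / (s : ℝ)) x)
      = logSum x - r * ∑ j, Real.log (colSum x j / (1 / (s : ℝ))) := by
  have h (y : Table r s) : logSum y = logSum fun j i => y i j := Finset.sum_comm
  rw [h, h x]
  exact logSum_rowScale (x := fun j i => x i j) (fun j i => hx i j)

lemma sum_normalized {n : ℕ} [NeZero n] {t : Fin n → ℝ} (h : ∑ i, t i = 1) :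
    ∑ i, (t i / (1 / (n : ℝ)) - 1) = 0 := by
  have hn : (n : ℝ) ≠ 0 := Nat.cast_ne_zero.2 (NeZero.ne n)
  rw [Finset.sum_sub_distrib, ← Finset.sum_div, h]
  simp

variable (r s) in
/-- One round of the procedure with uniform target margins. -/
noncomputable abbrev unifRound : Table r s → Table r s :=
  colScale (fun _ => 1 / (s : ℝ)) ∘ rowScale (fun _ => 1 / (r : ℝ))

lemma unifRound_pos {x : Table r s} (hx : ∀ i j, 0 < x i j) (i : Fin r) (j : Fin s) :
    0 < unifRound r s x i j :=
  colScale_pos (fun _ => unif_pos s) (rowScale_pos (fun _ => unif_pos r) hx) i j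

lemma sum_const_unif (n : ℕ) [NeZero n] : ∑ _ : Fin n, 1 / (n : ℝ) = 1 := by
  have hn : (n : ℝ) ≠ 0 := Nat.cast_ne_zero.2 (NeZero.ne n)
  simp [hn]

lemma sum_unifRound {x : Table r s} (hx : ∀ i j, 0 < x i j) :
    ∑ i, ∑ j, unifRound r s x i j = 1 := by
  rw [← sum_colSum]
  simp only [Function.comp,
    colSum_colScale _ (rowScale_pos (fun _ => unif_pos r) hx)]
  exact sum_const_unif s

lemma logOdds_unifRound (i₀ : Fin r) (j₀ : Fin s) {x : Table r s} (hx : ∀ i j, 0 < x i j) :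
    logOdds i₀ j₀ (unifRound r s x) = logOdds i₀ j₀ x := by
  rw [unifRound, Function.comp_apply, logOdds_colScale i₀ j₀ (fun _ => unif_pos s)
    (rowScale_pos (fun _ => unif_pos r) hx), logOdds_rowScale i₀ j₀ (fun _ => unif_pos r) hx]

lemma continuousAt_unifRound {x : Table r s} (hx : ∀ i j, 0 < x i j) :
    ContinuousAt (unifRound r s) x :=
  (continuousAt_colScale _ (rowScale_pos (fun _ => unif_pos r) hx)).comp
    (continuousAt_rowScale _ hx)

lemma sum_rowScale_unif {x : Table r s} (hx : ∀ i j, 0 < x i j) :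
    ∑ i, ∑ j, rowScale (fun _ => 1 / (r : ℝ)) x i j = 1 := by
  rw [← sum_rowSum]
  simp only [rowSum_rowScale _ hx]
  exact sum_const_unif r

/-- The gain is `-s` times the sum of the logs of the normalized row sums. These average to one, so
that sum of logs is nonpositive. -/
lemma logSum_le_rowScale {x : Table r s} (hx : ∀ i j, 0 < x i j) (h1 : ∑ i, ∑ j, x i j = 1) :
    logSum x ≤ logSum (rowScale (fun _ => 1 / (r : ℝ)) x) := by
  have h := sum_log_nonpos (fun i => div_pos (rowSum_pos hx i) (unif_pos r))
    (sum_normalized ((sum_rowSum x).trans h1))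
  rw [logSum_rowScale hx]
  nlinarith [mul_nonneg (Nat.cast_nonneg (α := ℝ) s) (neg_nonneg.2 h)]

lemma logSum_le_colScale {x : Table r s} (hx : ∀ i j, 0 < x i j) (h1 : ∑ i, ∑ j, x i j = 1) :
    logSum x ≤ logSum (colScale (fun _ => 1 / (s : ℝ)) x) := by
  have h := sum_log_nonpos (fun j => div_pos (colSum_pos hx j) (unif_pos s))
    (sum_normalized ((sum_colSum x).trans h1))
  rw [logSum_colScale hx]
  nlinarith [mul_nonneg (Nat.cast_nonneg (α := ℝ) r) (neg_nonneg.2 h)]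

lemma logSum_le_unifRound {x : Table r s} (hx : ∀ i j, 0 < x i j) (h1 : ∑ i, ∑ j, x i j = 1) :
    logSum x ≤ logSum (unifRound r s x) :=
  (logSum_le_rowScale hx h1).trans
    (logSum_le_colScale (rowScale_pos (fun _ => unif_pos r) hx) (sum_rowScale_unif hx))

lemma rowSum_eq_unif_of_logSum_eq {x : Table r s} (hx : ∀ i j, 0 < x i j)
    (h1 : ∑ i, ∑ j, x i j = 1)
    (h : logSum (rowScale (fun _ => 1 / (r : ℝ)) x) = logSum x) (i : Fin r) :
    rowSum x i = 1 / r := by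
  rw [logSum_rowScale hx, sub_eq_self, mul_eq_zero,
    or_iff_right (Nat.cast_ne_zero.2 (NeZero.ne s))] at h
  have := eq_one_of_sum_log_eq_zero (fun i => div_pos (rowSum_pos hx i) (unif_pos r))
    (sum_normalized ((sum_rowSum x).trans h1)) h i
  exact (div_eq_one_iff_eq (unif_pos r).ne').1 this

lemma colSum_eq_unif_of_logSum_eq {x : Table r s} (hx : ∀ i j, 0 < x i j)
    (h1 : ∑ i, ∑ j, x i j = 1)
    (h : logSum (colScale (fun _ => 1 / (s : ℝ)) x) = logSum x) (j : Fin s) :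
    colSum x j = 1 / s := by
  rw [logSum_colScale hx, sub_eq_self, mul_eq_zero,
    or_iff_right (Nat.cast_ne_zero.2 (NeZero.ne r))] at h
  have := eq_one_of_sum_log_eq_zero (fun j => div_pos (colSum_pos hx j) (unif_pos s))
    (sum_normalized ((sum_colSum x).trans h1)) h j
  exact (div_eq_one_iff_eq (unif_pos s).ne').1 this

/-- Neither half of the round can decrease `logSum`, so both leave it unchanged. The row half forces
uniform row sums; row scaling is then the identity, and the column half acts on `x` itself. -/
lemma margins_of_logSum_unifRound_eq {x : Table r s} (hx : ∀ i j, 0 < x i j)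
    (h1 : ∑ i, ∑ j, x i j = 1) (h : logSum (unifRound r s x) = logSum x) :
    (∀ i, rowSum x i = 1 / r) ∧ ∀ j, colSum x j = 1 / s := by
  have ha := logSum_le_rowScale hx h1
  have hb := logSum_le_colScale (rowScale_pos (fun _ => unif_pos r) hx) (sum_rowScale_unif hx)
  have hrow := rowSum_eq_unif_of_logSum_eq hx h1 (le_antisymm (hb.trans h.le) ha)
  refine ⟨hrow, colSum_eq_unif_of_logSum_eq hx h1 ?_⟩
  rwa [unifRound, Function.comp_apply, rowScale_eq_self hx hrow] at h

/-- `u` is the positive table with uniform margins and the odds ratios of `x`. -/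
structure IsCopulaOf (u x : Table r s) : Prop where
  pos : ∀ i j, 0 < u i j
  rowSum_eq : ∀ i, rowSum u i = 1 / r
  colSum_eq : ∀ j, colSum u j = 1 / s
  logOdds_eq : logOdds (lastIdx r) (lastIdx s) u = logOdds (lastIdx r) (lastIdx s) x

lemma IsCopulaOf.unique {u v x : Table r s} (hu : IsCopulaOf u x) (hv : IsCopulaOf v x) : u = v :=
  eq_of_margins_of_logOdds hu.pos hv.pos
    (fun i => (hu.rowSum_eq i).trans (hv.rowSum_eq i).symm)
    (fun j => (hu.colSum_eq j).trans (hv.colSum_eq j).symm) _ _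
    (hu.logOdds_eq.trans hv.logOdds_eq.symm)

lemma iterate_unifRound {x : Table r s} (hx : ∀ i j, 0 < x i j) (h1 : ∑ i, ∑ j, x i j = 1)
    (n : ℕ) :
    (∀ i j, 0 < (unifRound r s)^[n] x i j) ∧ ∑ i, ∑ j, (unifRound r s)^[n] x i j = 1 ∧
      logOdds (lastIdx r) (lastIdx s) ((unifRound r s)^[n] x)
        = logOdds (lastIdx r) (lastIdx s) x := by
  induction n with
  | zero => exact ⟨hx, h1, rfl⟩
  | succ n ih =>
    rw [Function.iterate_succ_apply']
    exact ⟨unifRound_pos ih.1, sum_unifRound ih.1, (logOdds_unifRound _ _ ih.1).trans ih.2.2⟩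

/-- A Lyapunov argument: in a compact set, a sequence whose cluster points all coincide converges.
-/
lemma exists_tendsto_iterate_unifRound {x : Table r s} (hx : ∀ i j, 0 < x i j)
    (h1 : ∑ i, ∑ j, x i j = 1) :
    ∃ u, IsCopulaOf u x ∧ Tendsto (fun n => (unifRound r s)^[n] x) atTop (𝓝 u) := by
  set z : ℕ → Table r s := fun n => (unifRound r s)^[n] x with hz
  have hzs (n : ℕ) : z (n + 1) = unifRound r s (z n) := Function.iterate_succ_apply' _ _ _
  have hzp (n : ℕ) := (iterate_unifRound hx h1 n).1
  have hz1 (n : ℕ) := (iterate_unifRound hx h1 n).2.1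
  have hzo (n : ℕ) := (iterate_unifRound hx h1 n).2.2
  have hmono : Monotone fun n => logSum (z n) := monotone_nat_of_le_succ fun n => by
    rw [hzs]; exact logSum_le_unifRound (hzp n) (hz1 n)
  have hbdd : BddAbove (Set.range fun n => logSum (z n)) := by
    refine ⟨0, ?_⟩
    rintro _ ⟨n, rfl⟩
    exact (logSum_le_log (hzp n) (hz1 n) (lastIdx r) (lastIdx s)).trans
      (Real.log_nonpos (hzp n _ _).le (le_one_of_sum_eq_one (hzp n) (hz1 n) _ _))
  obtain ⟨l, hl⟩ : ∃ l, Tendsto (fun n => logSum (z n)) atTop (𝓝 l) :=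
    ⟨_, tendsto_atTop_ciSup hmono hbdd⟩
  -- The positive lower bound, inherited from the start by monotonicity of `logSum`, keeps cluster
  -- points where the scalings and logarithms are continuous.
  set K : Set (Table r s) := Set.Icc (fun _ _ => Real.exp (logSum x)) (fun _ _ => 1) with hK
  have hKc : IsCompact K := isCompact_Icc
  have hzK (n : ℕ) : z n ∈ K := by
    refine ⟨fun i j => ?_, fun i j => le_one_of_sum_eq_one (hzp n) (hz1 n) i j⟩
    rw [← Real.le_log_iff_exp_le (hzp n i j)]
    exact (hmono (Nat.zero_le n)).trans (logSum_le_log (hzp n) (hz1 n) i j)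
  have hclus {y : Table r s} (hy : y ∈ K) {φ : ℕ → ℕ} (hφ : StrictMono φ)
      (hlim : Tendsto (z ∘ φ) atTop (𝓝 y)) : IsCopulaOf y x := by
    have hyp (i : Fin r) (j : Fin s) : 0 < y i j := (Real.exp_pos _).trans_le (hy.1 i j)
    have hy1 : ∑ i, ∑ j, y i j = 1 := by
      have hc : Continuous fun w : Table r s => ∑ i, ∑ j, w i j := by fun_prop
      refine tendsto_nhds_unique ((hc.tendsto y).comp hlim) ?_
      exact tendsto_const_nhds.congr fun n => (hz1 (φ n)).symm
    have e1 : logSum y = l :=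
      tendsto_nhds_unique ((continuousAt_logSum hyp).tendsto.comp hlim)
        (hl.comp hφ.tendsto_atTop)
    -- `unifRound r s y` is the limit of the subsequence shifted by one round, along which `logSum`
    -- has the same limit `l`; hence a round leaves `logSum y` unchanged.
    have e2 : logSum (unifRound r s y) = l := by
      refine tendsto_nhds_unique
        ((continuousAt_logSum (unifRound_pos hyp)).tendsto.comp
          ((continuousAt_unifRound hyp).tendsto.comp hlim)) ?_
      refine (hl.comp ((tendsto_add_atTop_nat 1).comp hφ.tendsto_atTop)).congr fun n => ?_
      simp only [Function.comp_apply, hzs]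
    obtain ⟨hrow, hcol⟩ := margins_of_logSum_unifRound_eq hyp hy1 (e2.trans e1.symm)
    refine ⟨hyp, hrow, hcol, ?_⟩
    refine tendsto_nhds_unique ((continuousAt_logOdds _ _ hyp).tendsto.comp hlim) ?_
    exact tendsto_const_nhds.congr fun n => (hzo (φ n)).symm
  obtain ⟨u, huK, φ, hφ, hlim⟩ := hKc.tendsto_subseq hzK
  have hu := hclus huK hφ hlim
  refine ⟨u, hu, hKc.tendsto_nhds_of_unique_mapClusterPt (Eventually.of_forall hzK) ?_⟩
  intro y hy hmc
  obtain ⟨ψ, hψ, hlim'⟩ := hmc.tendsto_subseq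
  exact (hclus hy hψ hlim').unique hu

/-- The procedure with uniform target margins converges when started at a positive table. -/
lemma exists_tendsto_ipfpStep {x : Table r s} (hx : ∀ i j, 0 < x i j) :
    ∃ u, IsCopulaOf u x ∧ Tendsto
      (fun N => ipfpStep (fun _ => 1 / (r : ℝ)) (fun _ => 1 / (s : ℝ)) N x) atTop (𝓝 u) := by
  -- The total mass of `x` is arbitrary here; after one round it is one.
  obtain ⟨u, hu, hlim⟩ := exists_tendsto_iterate_unifRound (unifRound_pos hx) (sum_unifRound hx)
  have hu' : IsCopulaOf u x :=
    ⟨hu.pos, hu.rowSum_eq, hu.colSum_eq, hu.logOdds_eq.trans (logOdds_unifRound _ _ hx)⟩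
  have heven : Tendsto (fun n => (unifRound r s)^[n] x) atTop (𝓝 u) := by
    rw [← tendsto_add_atTop_iff_nat 1]
    exact hlim
  -- Odd steps end with a row scaling, which is continuous at `u` and fixes it.
  have hodd : Tendsto (fun n => rowScale (fun _ => 1 / (r : ℝ)) ((unifRound r s)^[n] x)) atTop
      (𝓝 u) := by
    have := (continuousAt_rowScale (fun _ => 1 / (r : ℝ)) hu.pos).tendsto.comp heven
    rwa [rowScale_eq_self hu.pos hu.rowSum_eq] at this
  have hdiv : Tendsto (fun N : ℕ => N / 2) atTop atTop :=
    Nat.tendsto_div_const_atTop two_ne_zero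
  refine ⟨u, hu', Tendsto.if' (hodd.comp hdiv) (heven.comp hdiv)⟩

lemma isCopulaOf_copula {x : Table r s} (hx : ∀ i j, 0 < x i j) : IsCopulaOf (copula x) x := by
  obtain ⟨u, hu, hlim⟩ := exists_tendsto_ipfpStep hx
  have : copula x = u := hlim.limUnder_eq
  rwa [this]

end Convergence

/-! ### Separating the last label from the others. -/

section LastIndex

variable {r : ℕ} [NeZero r]

omit [NeZero r] in
lemma val_low (k : Fin (r - 1)) : ((low k : Fin r) : ℕ) = k := rfl

lemma val_lastIdx : (lastIdx r : ℕ) = r - 1 := rfl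

lemma low_ne_lastIdx (k : Fin (r - 1)) : low k ≠ lastIdx r := by
  intro h
  have := congrArg Fin.val h
  rw [val_low, val_lastIdx] at this
  omega

lemma eq_lastIdx_or_exists_low (i : Fin r) : i = lastIdx r ∨ ∃ k, i = low k := by
  by_cases h : (i : ℕ) = r - 1
  · exact Or.inl (Fin.ext h)
  · exact Or.inr ⟨⟨i, by omega⟩, rfl⟩

lemma sum_eq_sum_low_add_last (f : Fin r → ℝ) :
    ∑ i, f i = ∑ k, f (low k) + f (lastIdx r) := by
  rcases r with _ | m
  · exact absurd rfl (NeZero.ne 0)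
  · exact Fin.sum_univ_castSucc f

omit [NeZero r] in
lemma matH_low (k t : Fin (r - 1)) : matH r (low k) t = if t = k then 1 else 0 := by
  simp [matH, val_low, show (k : ℕ) ≠ r - 1 by omega, Fin.ext_iff, eq_comm]

lemma matH_lastIdx (t : Fin (r - 1)) : matH r (lastIdx r) t = -1 := by
  simp [matH, val_lastIdx, show r - 1 ≠ (t : ℕ) by omega]

lemma sum_matH (t : Fin (r - 1)) : ∑ i, matH r i t = 0 := by
  rw [sum_eq_sum_low_add_last]
  simp [matH_low, matH_lastIdx]

end LastIndex

/-! ### The derivative of the copula map. -/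

section Derivative

variable {r s : ℕ} [NeZero r] [NeZero s]

omit [NeZero r] [NeZero s] in
-- `K` has Kronecker product structure. Since the columns of each `H` sum to zero, its image
-- consists of tables with vanishing margins.
lemma matK_eq_mul (q : Fin r × Fin s) (t : Fin (r - 1) × Fin (s - 1)) :
    matK r s q t = matH r q.1 t.1 * matH s q.2 t.2 := by
  simp only [matK, matH, Matrix.of_apply]
  split_ifs <;> simp

variable (r s) in
/-- The linear map with matrix `K`, with values in the tables. -/
noncomputable def marginFree : (Fin (r - 1) × Fin (s - 1) → ℝ) →L[ℝ] Table r s :=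
  LinearMap.toContinuousLinearMap
    { toFun := fun z i j => (matK r s).mulVec z (i, j)
      map_add' := fun z w => by funext i j; simp [Matrix.mulVec_add]
      map_smul' := fun c z => by funext i j; simp [Matrix.mulVec_smul] }

omit [NeZero r] [NeZero s] in
lemma marginFree_apply (z : Fin (r - 1) × Fin (s - 1) → ℝ) (i : Fin r) (j : Fin s) :
    marginFree r s z i j = ∑ t, matH r i t.1 * matH s j t.2 * z t := by
  simp only [← matK_eq_mul (i, j)]
  rfl

omit [NeZero r] in
lemma rowSum_marginFree (z : Fin (r - 1) × Fin (s - 1) → ℝ) (i : Fin r) :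
    rowSum (marginFree r s z) i = 0 := by
  simp only [rowSum, marginFree_apply]
  rw [Finset.sum_comm]
  refine Finset.sum_eq_zero fun t _ => ?_
  rw [← Finset.sum_mul, ← Finset.mul_sum, sum_matH, mul_zero, zero_mul]

omit [NeZero s] in
lemma colSum_marginFree (z : Fin (r - 1) × Fin (s - 1) → ℝ) (j : Fin s) :
    colSum (marginFree r s z) j = 0 := by
  simp only [colSum, marginFree_apply]
  rw [Finset.sum_comm]
  refine Finset.sum_eq_zero fun t _ => ?_
  rw [← Finset.sum_mul, ← Finset.sum_mul, sum_matH, zero_mul, zero_mul]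

omit [NeZero r] [NeZero s] in
lemma marginFree_low_low (z : Fin (r - 1) × Fin (s - 1) → ℝ) (k : Fin (r - 1))
    (l : Fin (s - 1)) : marginFree r s z (low k) (low l) = z (k, l) := by
  rw [marginFree_apply, Finset.sum_eq_single (k, l)]
  · simp [matH_low]
  · rintro ⟨i, j⟩ - hne
    rw [matH_low, matH_low]
    by_cases h1 : i = k <;> by_cases h2 : j = l <;> simp_all
  · simp

/-- The log odds ratios of a table relative to its last cell. -/
noncomputable def freeLogOdds (x : Table r s) : Fin (r - 1) × Fin (s - 1) → ℝ :=
  fun t => logOdds (lastIdx r) (lastIdx s) x (low t.1) (low t.2)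

/-- In the last row and the last column the log odds ratios cancel identically, so the free cells
carry all the information. -/
lemma logOdds_eq_of_freeLogOdds_eq {x y : Table r s} (h : freeLogOdds x = freeLogOdds y) :
    logOdds (lastIdx r) (lastIdx s) x = logOdds (lastIdx r) (lastIdx s) y := by
  funext i j
  rcases eq_lastIdx_or_exists_low i with rfl | ⟨k, rfl⟩
  · simp [logOdds]
  rcases eq_lastIdx_or_exists_low j with rfl | ⟨l, rfl⟩
  · simp [logOdds]
  exact congrFun h (k, l)

lemma freeLogOdds_eq_of_isCopulaOf {u x : Table r s} (h : IsCopulaOf u x) :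
    freeLogOdds u = freeLogOdds x := by
  funext t
  simp only [freeLogOdds, h.logOdds_eq]

omit [NeZero r] [NeZero s] in
/-- The coordinate functional of a cell. -/
noncomputable def entry (i : Fin r) (j : Fin s) : Table r s →L[ℝ] ℝ :=
  (ContinuousLinearMap.proj (R := ℝ) (φ := fun _ : Fin s => ℝ) j).comp
    (ContinuousLinearMap.proj (R := ℝ) (φ := fun _ : Fin r => Fin s → ℝ) i)

omit [NeZero r] [NeZero s] in
@[simp] lemma entry_apply (i : Fin r) (j : Fin s) (x : Table r s) : entry i j x = x i j := rfl

/-- The derivative of `freeLogOdds`. -/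
noncomputable def freeLogOddsDeriv (x : Table r s) :
    Table r s →L[ℝ] (Fin (r - 1) × Fin (s - 1) → ℝ) :=
  ContinuousLinearMap.pi fun t =>
    (x (low t.1) (low t.2))⁻¹ • entry (low t.1) (low t.2)
      - (x (low t.1) (lastIdx s))⁻¹ • entry (low t.1) (lastIdx s)
      - (x (lastIdx r) (low t.2))⁻¹ • entry (lastIdx r) (low t.2)
      + (x (lastIdx r) (lastIdx s))⁻¹ • entry (lastIdx r) (lastIdx s)

lemma freeLogOddsDeriv_apply (x v : Table r s) (k : Fin (r - 1)) (l : Fin (s - 1)) :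
    freeLogOddsDeriv x v (k, l) =
      v (low k) (low l) / x (low k) (low l)
        - v (low k) (lastIdx s) / x (low k) (lastIdx s)
        - v (lastIdx r) (low l) / x (lastIdx r) (low l)
        + v (lastIdx r) (lastIdx s) / x (lastIdx r) (lastIdx s) := by
  simp [freeLogOddsDeriv, div_eq_inv_mul]

lemma hasStrictFDerivAt_freeLogOdds {x : Table r s} (hx : ∀ i j, 0 < x i j) :
    HasStrictFDerivAt freeLogOdds (freeLogOddsDeriv x) x := by
  have h (i : Fin r) (j : Fin s) :
      HasStrictFDerivAt (fun y : Table r s => Real.log (y i j)) ((x i j)⁻¹ • entry i j) x :=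
    HasStrictFDerivAt.log (f := fun y : Table r s => y i j) (entry i j).hasStrictFDerivAt
      (hx i j).ne'
  exact hasStrictFDerivAt_pi.2 fun t => (((h _ _).sub (h _ _)).sub (h _ _)).add (h _ _)

omit [NeZero s] in
lemma last_row_eq {u : Table r s} (hcol : ∀ j, colSum u j = 1 / s) (j : Fin s) :
    u (lastIdx r) j = 1 / (s : ℝ) - ∑ g : Fin (r - 1), u (low g) j := by
  have := hcol j
  rw [colSum, sum_eq_sum_low_add_last] at this
  linarith

omit [NeZero r] in
lemma last_col_eq {u : Table r s} (hrow : ∀ i, rowSum u i = 1 / r) (i : Fin r) :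
    u i (lastIdx s) = 1 / (r : ℝ) - ∑ h : Fin (s - 1), u i (low h) := by
  have := hrow i
  rw [rowSum, sum_eq_sum_low_add_last] at this
  linarith

lemma last_last_eq {u : Table r s} (hrow : ∀ i, rowSum u i = 1 / r)
    (hcol : ∀ j, colSum u j = 1 / s) :
    u (lastIdx r) (lastIdx s) = 1 / (r : ℝ) + 1 / (s : ℝ) - 1
      + ∑ g : Fin (r - 1), ∑ h : Fin (s - 1), u (low g) (low h) := by
  have h1 : ∑ i, u i (lastIdx s) = 1 / (s : ℝ) := hcol (lastIdx s)
  have h2 : ∑ i, ∑ h : Fin (s - 1), u i (low h)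
      = ∑ i : Fin r, 1 / (r : ℝ) - 1 / (s : ℝ) := by
    rw [← h1, ← Finset.sum_sub_distrib]
    exact Finset.sum_congr rfl fun i _ => by rw [last_col_eq hrow]; ring
  rw [sum_const_unif, sum_eq_sum_low_add_last] at h2
  have h3 := last_col_eq hrow (lastIdx r)
  linarith

/-- `L_u` is the matrix of the derivative of the log odds ratios along tables with vanishing
margins. -/
lemma freeLogOddsDeriv_marginFree {u : Table r s} (hrow : ∀ i, rowSum u i = 1 / r)
    (hcol : ∀ j, colSum u j = 1 / s) (z : Fin (r - 1) × Fin (s - 1) → ℝ) :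
    freeLogOddsDeriv u (marginFree r s z) = (matL u).mulVec z := by
  funext ⟨k, l⟩
  rw [freeLogOddsDeriv_apply]
  -- With uniform margins, the denominators in `L_u` are the entries of `u` in the last row, the
  -- last column and the corner.
  simp only [marginFree_apply, Matrix.mulVec, dotProduct, matL, Matrix.of_apply, Finset.sum_div,
    ← last_row_eq hcol, ← last_col_eq hrow, ← last_last_eq hrow hcol,
    ← Finset.sum_sub_distrib, ← Finset.sum_add_distrib, matH_low, matH_lastIdx]
  refine Finset.sum_congr rfl fun t _ => ?_
  by_cases h1 : t.1 = k <;> by_cases h2 : t.2 = l <;> simp [h1, h2] <;> ring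

/-- For `w = K z` in the kernel, `w / u` is additive while `w` has vanishing margins. Orthogonality
gives `∑ w² / u = 0`, so `w` vanishes, and `z` is read off from its free cells. -/
lemma matL_mulVec_eq_zero {u : Table r s} (hpos : ∀ i j, 0 < u i j)
    (hrow : ∀ i, rowSum u i = 1 / r) (hcol : ∀ j, colSum u j = 1 / s)
    {z : Fin (r - 1) × Fin (s - 1) → ℝ} (hz : (matL u).mulVec z = 0) : z = 0 := by
  rw [← freeLogOddsDeriv_marginFree hrow hcol] at hz
  set w := marginFree r s z with hw
  have hsum := sum_mul_eq_zero_of_additive (w := w) (e := fun i j => w i j / u i j)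
    (lastIdx r) (lastIdx s) (rowSum_marginFree z) (colSum_marginFree z) (fun i j => by
      rcases eq_lastIdx_or_exists_low i with rfl | ⟨k, rfl⟩
      · ring
      rcases eq_lastIdx_or_exists_low j with rfl | ⟨l, rfl⟩
      · ring
      rw [← freeLogOddsDeriv_apply, hz, Pi.zero_apply])
  have hnn (i : Fin r) (j : Fin s) : 0 ≤ w i j * (w i j / u i j) := by
    rw [← mul_div_assoc]
    exact div_nonneg (mul_self_nonneg _) (hpos i j).le
  rw [Finset.sum_eq_zero_iff_of_nonneg fun i _ => Finset.sum_nonneg fun j _ => hnn i j] at hsum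
  funext ⟨k, l⟩
  have h1 := hsum (low k) (Finset.mem_univ _)
  rw [Finset.sum_eq_zero_iff_of_nonneg fun j _ => hnn _ j] at h1
  have h2 := h1 (low l) (Finset.mem_univ _)
  rw [hw, marginFree_low_low] at h2
  simpa [(hpos (low k) (low l)).ne'] using h2

lemma isUnit_det_matL {u : Table r s} (hpos : ∀ i j, 0 < u i j)
    (hrow : ∀ i, rowSum u i = 1 / r) (hcol : ∀ j, colSum u j = 1 / s) :
    IsUnit (matL u).det := by
  rw [← Matrix.isUnit_iff_isUnit_det, ← Matrix.mulVec_injective_iff_isUnit]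
  intro z w h
  rw [← sub_eq_zero] at h ⊢
  exact matL_mulVec_eq_zero hpos hrow hcol (by rw [Matrix.mulVec_sub]; exact h)

/-- The derivative of the copula map, as a continuous linear map. -/
noncomputable def copulaDeriv (u p : Table r s) : Table r s →L[ℝ] Table r s :=
  (marginFree r s).comp
    ((Matrix.mulVecLin (matL u)⁻¹).toContinuousLinearMap.comp (freeLogOddsDeriv p))

omit [NeZero r] [NeZero s] in
lemma eventually_pos {x : Table r s} (hx : ∀ i j, 0 < x i j) : ∀ᶠ y in 𝓝 x, ∀ i j, 0 < y i j := by
  refine eventually_all.2 fun i => eventually_all.2 fun j => ?_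
  exact (continuous_entry i j).continuousAt.eventually_const_lt (hx i j)

/-- The inverse function theorem in the chart `z ↦ u + K z` gives a differentiable candidate near
`p`; uniqueness identifies it with the copula map. -/
lemma hasFDerivAt_copula {p : Table r s} (hp : ∀ i j, 0 < p i j) :
    HasFDerivAt copula (copulaDeriv (copula p) p) p := by
  have hu := isCopulaOf_copula hp
  set u := copula p with hu_def
  have hdet := isUnit_det_matL hu.pos hu.rowSum_eq hu.colSum_eq
  let e : (Fin (r - 1) × Fin (s - 1) → ℝ) ≃L[ℝ] (Fin (r - 1) × Fin (s - 1) → ℝ) :=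
    ContinuousLinearEquiv.equivOfInverse (Matrix.mulVecLin (matL u)).toContinuousLinearMap
      (Matrix.mulVecLin (matL u)⁻¹).toContinuousLinearMap
      (fun z => by simp [Matrix.mulVec_mulVec, Matrix.nonsing_inv_mul _ hdet])
      (fun z => by simp [Matrix.mulVec_mulVec, Matrix.mul_nonsing_inv _ hdet])
  let T : (Fin (r - 1) × Fin (s - 1) → ℝ) → Table r s := fun z => u + marginFree r s z
  have hT (z) : HasStrictFDerivAt T (marginFree r s) z :=
    (marginFree r s).hasStrictFDerivAt.const_add u
  have hT0 : T 0 = u := by simp [T]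
  have hΨ : HasStrictFDerivAt (freeLogOdds ∘ T)
      (e : (Fin (r - 1) × Fin (s - 1) → ℝ) →L[ℝ] (Fin (r - 1) × Fin (s - 1) → ℝ)) 0 := by
    have h1 : HasStrictFDerivAt freeLogOdds (freeLogOddsDeriv u) (T 0) := by
      rw [hT0]; exact hasStrictFDerivAt_freeLogOdds hu.pos
    refine (h1.comp 0 (hT 0)).congr_fderiv ?_
    ext1 z
    exact freeLogOddsDeriv_marginFree hu.rowSum_eq hu.colSum_eq z
  have hΨ0 : (freeLogOdds ∘ T) 0 = freeLogOdds p := by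
    rw [Function.comp_apply, hT0, freeLogOdds_eq_of_isCopulaOf hu]
  set g := hΨ.localInverse (freeLogOdds ∘ T) e 0 with hg
  have hgd : HasStrictFDerivAt g (e.symm : _ →L[ℝ] _) (freeLogOdds p) := by
    rw [← hΨ0]; exact hΨ.to_localInverse
  have hg0 : g (freeLogOdds p) = 0 := by
    rw [← hΨ0]; exact hΨ.localInverse_apply_image
  have hF : HasFDerivAt (fun x => T (g (freeLogOdds x))) (copulaDeriv u p) p :=
    ((hT _).comp p (hgd.comp p (hasStrictFDerivAt_freeLogOdds hp))).hasFDerivAt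
  refine hF.congr_of_eventuallyEq ?_
  have hF0 : T (g (freeLogOdds p)) = u := by rw [hg0, hT0]
  have hFpos : ∀ᶠ x in 𝓝 p, ∀ i j, 0 < T (g (freeLogOdds x)) i j := by
    have := hF.continuousAt
    rw [ContinuousAt, hF0] at this
    exact this.eventually (eventually_pos hu.pos)
  have hinv : ∀ᶠ x in 𝓝 p, freeLogOdds (T (g (freeLogOdds x))) = freeLogOdds x := by
    have := hΨ.eventually_right_inverse
    rw [hΨ0] at this
    exact (hasStrictFDerivAt_freeLogOdds hp).continuousAt.eventually this
  -- The candidate is positive and has the odds ratios of `x`; its margins are those of `u`, because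
  -- the chart adds only margin-free tables.
  filter_upwards [eventually_pos hp, hFpos, hinv] with x hx hxF hxi
  refine (isCopulaOf_copula hx).unique ⟨hxF, fun i => ?_, fun j => ?_,
    logOdds_eq_of_freeLogOdds_eq hxi⟩
  · have := rowSum_marginFree (g (freeLogOdds x)) i
    rw [← hu.rowSum_eq i]
    simp only [rowSum] at this
    simp [T, rowSum, Finset.sum_add_distrib, this]
  · have := colSum_marginFree (g (freeLogOdds x)) j
    rw [← hu.colSum_eq j]
    simp only [colSum] at this
    simp [T, colSum, Finset.sum_add_distrib, this]

lemma sum_freeCell (f : Fin r × Fin s → ℝ) :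
    ∑ q : FreeCell r s, f q.1 = ∑ q, f q - f (lastIdx r, lastIdx s) := by
  rw [Fintype.sum_eq_add_sum_subtype_ne f (lastIdx r, lastIdx s)]
  ring

/-- The constant term of `M_p` multiplies the sum of `v` over the free cells. As `v` has total zero,
this sum is minus the dropped last entry, which restores the corner term of the derivative. -/
lemma matM_mulVec_matN {p v : Table r s} (hp : ∑ i, ∑ j, p i j = 1) (hv : ∑ i, ∑ j, v i j = 0) :
    (matM p).mulVec ((matN r s).mulVec (vec v)) = -freeLogOddsDeriv p v := by
  have hN : (matN r s).mulVec (vec v) = fun q => vec v q.1 := by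
    funext q
    simp [matN, Matrix.mulVec, dotProduct]
  have hp' : 1 - ∑ q : FreeCell r s, p q.1.1 q.1.2 = p (lastIdx r) (lastIdx s) := by
    rw [sum_freeCell fun q => p q.1 q.2, Fintype.sum_prod_type, hp]
    ring
  rw [hN]
  funext ⟨k, l⟩
  have h1 : (low k, low l) ≠ (lastIdx r, lastIdx s) := fun h =>
    low_ne_lastIdx k (congrArg Prod.fst h)
  have h2 : (lastIdx r, low l) ≠ (lastIdx r, lastIdx s) := fun h =>
    low_ne_lastIdx l (congrArg Prod.snd h)
  have h3 : (low k, lastIdx s) ≠ (lastIdx r, lastIdx s) := fun h =>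
    low_ne_lastIdx k (congrArg Prod.fst h)
  have hv' : ∑ q, vec v q = 0 := by rw [Fintype.sum_prod_type]; exact hv
  rw [Pi.neg_apply, freeLogOddsDeriv_apply]
  simp only [matM, Matrix.mulVec, dotProduct, Matrix.of_apply, hp']
  rw [sum_freeCell fun q => (-((if q = (low k, low l) then 1 else 0) / p (low k) (low l))
      + (if q = (lastIdx r, low l) then 1 else 0) / p (lastIdx r) (low l)
      + (if q = (low k, lastIdx s) then 1 else 0) / p (low k) (lastIdx s)
      + 1 / p (lastIdx r) (lastIdx s)) * vec v q]
  simp only [add_mul, Finset.sum_add_distrib, neg_mul, Finset.sum_neg_distrib, ite_div, zero_div,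
    ite_mul, zero_mul, Finset.sum_ite_eq', Finset.mem_univ, if_true,
    ← Finset.mul_sum, hv', h1.symm, h2.symm, h3.symm, if_false]
  simp only [vec]
  ring

lemma matJ_mulVec {u p v : Table r s} (hp : ∑ i, ∑ j, p i j = 1) (hv : ∑ i, ∑ j, v i j = 0) :
    (matJ u p).mulVec (vec v) = vec (copulaDeriv u p v) := by
  rw [matJ, Matrix.neg_mulVec, ← Matrix.mulVec_mulVec, ← Matrix.mulVec_mulVec,
    matM_mulVec_matN hp hv, Matrix.mulVec_neg, neg_neg, ← Matrix.mulVec_mulVec]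
  rfl

end Derivative

/-! ### Partial derivatives and the total derivative. -/

section Gradient

variable {r s : ℕ}

lemma sum_smul_unitTable (v : Table r s) : ∑ q, vec v q • unitTable q = v := by
  funext i j
  simp [Finset.sum_apply, unitTable, vec]

lemma fderiv_eq_grad_dotProduct {η : Table r s → ℝ} {x : Table r s}
    (h : DifferentiableAt ℝ η x) (v : Table r s) : fderiv ℝ η x v = grad η x ⬝ᵥ vec v := by
  conv_lhs => rw [← sum_smul_unitTable v]
  simp only [map_sum, map_smul, smul_eq_mul, dotProduct, grad, h.lineDeriv_eq_fderiv]
  exact Finset.sum_congr rfl fun q _ => mul_comm _ _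

end Gradient

/-! ### Differentiability of the three coefficients. -/

section Differentiability

variable {r s : ℕ}

lemma differentiable_entry (i : Fin r) (j : Fin s) : Differentiable ℝ fun x : Table r s => x i j :=
  (entry i j).differentiable

lemma differentiable_rowSum (i : Fin r) : Differentiable ℝ fun x : Table r s => rowSum x i :=
  Differentiable.fun_sum fun j _ => differentiable_entry i j

lemma differentiable_colSum (j : Fin s) : Differentiable ℝ fun x : Table r s => colSum x j :=
  Differentiable.fun_sum fun i _ => differentiable_entry i j

lemma differentiable_yule : Differentiable ℝ (yule : Table r s → ℝ) := by
  refine Differentiable.const_mul (Differentiable.sub_const (Differentiable.const_mul ?_ _) _) _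
  exact Differentiable.fun_sum fun i _ => Differentiable.fun_sum fun j _ =>
    (differentiable_entry i j).const_mul _

lemma differentiable_pairSum (A : Fin r → Fin s → Fin r → Fin s → Prop)
    [∀ i j i' j', Decidable (A i j i' j')] :
    Differentiable ℝ fun x : Table r s =>
      ∑ i, ∑ j, ∑ i', ∑ j', if A i j i' j' then x i j * x i' j' else 0 := by
  refine Differentiable.fun_sum fun i _ => Differentiable.fun_sum fun j _ =>
    Differentiable.fun_sum fun i' _ => Differentiable.fun_sum fun j' _ => ?_
  by_cases h : A i j i' j'
  · simpa only [if_pos h] using (differentiable_entry i j).fun_mul (differentiable_entry i' j')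
  · simpa only [if_neg h] using differentiable_const 0

lemma differentiable_concord : Differentiable ℝ (concord : Table r s → ℝ) :=
  differentiable_pairSum _

lemma differentiable_discord : Differentiable ℝ (discord : Table r s → ℝ) :=
  differentiable_pairSum _

lemma differentiable_neqRow : Differentiable ℝ (neqRow : Table r s → ℝ) := by
  refine Differentiable.fun_sum fun i _ => Differentiable.fun_sum fun i' _ => ?_
  by_cases h : i ≠ i'
  · simpa only [if_pos h] using (differentiable_rowSum i).fun_mul (differentiable_rowSum i')
  · simpa only [if_neg h] using differentiable_const 0

lemma differentiable_neqCol : Differentiable ℝ (neqCol : Table r s → ℝ) := by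
  refine Differentiable.fun_sum fun j _ => Differentiable.fun_sum fun j' _ => ?_
  by_cases h : j ≠ j'
  · simpa only [if_pos h] using (differentiable_colSum j).fun_mul (differentiable_colSum j')
  · simpa only [if_neg h] using differentiable_const 0

lemma sum_offDiag_pos {n : ℕ} (hn : 2 ≤ n) {t : Fin n → ℝ} (ht : ∀ i, 0 < t i) :
    0 < ∑ i, ∑ i', if i ≠ i' then t i * t i' else 0 := by
  have hnn (i i' : Fin n) : 0 ≤ if i ≠ i' then t i * t i' else 0 := by
    split_ifs
    exacts [(mul_pos (ht i) (ht i')).le, le_rfl]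
  refine Finset.sum_pos' (fun i _ => Finset.sum_nonneg fun i' _ => hnn i i')
    ⟨⟨0, by omega⟩, Finset.mem_univ _, ?_⟩
  refine Finset.sum_pos' (fun i' _ => hnn _ i') ⟨⟨1, by omega⟩, Finset.mem_univ _, ?_⟩
  rw [if_pos (by simp)]
  exact mul_pos (ht _) (ht _)

lemma discord_nonneg {x : Table r s} (hx : ∀ i j, 0 < x i j) : 0 ≤ discord x := by
  refine Finset.sum_nonneg fun i _ => Finset.sum_nonneg fun j _ =>
    Finset.sum_nonneg fun i' _ => Finset.sum_nonneg fun j' _ => ?_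
  split_ifs
  exacts [(mul_pos (hx i j) (hx i' j')).le, le_rfl]

/-- One concordant pair of cells, `(0, 0)` and `(1, 1)`, already contributes a positive term. This
keeps the denominator of gamma away from zero. -/
lemma concord_pos (hr : 2 ≤ r) (hs : 2 ≤ s) {x : Table r s} (hx : ∀ i j, 0 < x i j) :
    0 < concord x := by
  have hnn (i : Fin r) (j : Fin s) (i' : Fin r) (j' : Fin s) :
      0 ≤ if 0 < (((i : ℕ) : ℤ) - ((i' : ℕ) : ℤ)) * (((j : ℕ) : ℤ) - ((j' : ℕ) : ℤ))
        then x i j * x i' j' else 0 := by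
    split_ifs
    exacts [(mul_pos (hx i j) (hx i' j')).le, le_rfl]
  refine Finset.sum_pos' (fun i _ => Finset.sum_nonneg fun j _ => Finset.sum_nonneg fun i' _ =>
    Finset.sum_nonneg fun j' _ => hnn i j i' j') ⟨⟨0, by omega⟩, Finset.mem_univ _, ?_⟩
  refine Finset.sum_pos' (fun j _ => Finset.sum_nonneg fun i' _ =>
    Finset.sum_nonneg fun j' _ => hnn _ j i' j') ⟨⟨0, by omega⟩, Finset.mem_univ _, ?_⟩
  refine Finset.sum_pos' (fun i' _ => Finset.sum_nonneg fun j' _ => hnn _ _ i' j')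
    ⟨⟨1, by omega⟩, Finset.mem_univ _, ?_⟩
  refine Finset.sum_pos' (fun j' _ => hnn _ _ _ j') ⟨⟨1, by omega⟩, Finset.mem_univ _, ?_⟩
  rw [if_pos (by simp)]
  exact mul_pos (hx _ _) (hx _ _)

lemma differentiableAt_gkGamma (hr : 2 ≤ r) (hs : 2 ≤ s) {x : Table r s}
    (hx : ∀ i j, 0 < x i j) : DifferentiableAt ℝ gkGamma x := by
  have hnum : DifferentiableAt ℝ (fun y : Table r s => concord y - discord y) x :=
    (differentiable_concord x).sub (differentiable_discord x)
  have hden : DifferentiableAt ℝ (fun y : Table r s => concord y + discord y) x :=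
    (differentiable_concord x).add (differentiable_discord x)
  have hne := (add_pos_of_pos_of_nonneg (concord_pos hr hs hx) (discord_nonneg hx)).ne'
  simpa only [← div_eq_mul_inv] using! hnum.fun_mul (hden.fun_inv hne)

lemma differentiableAt_tauB [NeZero r] [NeZero s] (hr : 2 ≤ r) (hs : 2 ≤ s) {x : Table r s}
    (hx : ∀ i j, 0 < x i j) : DifferentiableAt ℝ tauB x := by
  have h : 0 < neqRow x * neqCol x :=
    mul_pos (sum_offDiag_pos hr (rowSum_pos hx)) (sum_offDiag_pos hs (colSum_pos hx))
  have hnum : DifferentiableAt ℝ (fun y : Table r s => concord y - discord y) x :=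
    (differentiable_concord x).sub (differentiable_discord x)
  have hden : DifferentiableAt ℝ (fun y : Table r s => √(neqRow y * neqCol y)) x :=
    ((differentiable_neqRow x).mul (differentiable_neqCol x)).sqrt h.ne'
  simpa only [← div_eq_mul_inv] using! hnum.fun_mul (hden.fun_inv (Real.sqrt_pos.2 h).ne')

end Differentiability

/-! ### Stochastic boundedness and the perturbed delta method. -/

section InProbability

variable {Ω : Type*} [MeasurableSpace Ω] {P : Measure Ω} {E : Type*} [NormedAddCommGroup E]

/-- Stochastic boundedness of a sequence of random vectors. -/
def BoundedInProb (P : Measure Ω) (V : ℕ → Ω → E) : Prop :=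
  ∀ ε : ℝ, 0 < ε → ∃ C : ℝ, ∀ᶠ n in atTop, P.real {ω | C ≤ ‖V n ω‖} ≤ ε

/-- The limit law gives little mass to `{N ≤ ‖x‖}` for large `N`. These sets are closed, so the
portmanteau theorem carries the bound to large `n`. -/
lemma BoundedInProb.of_tendstoInDistribution [IsProbabilityMeasure P] [MeasurableSpace E]
    [BorelSpace E] {Ω' : Type*} [MeasurableSpace Ω'] {P' : Measure Ω'} [IsProbabilityMeasure P']
    {V : ℕ → Ω → E} {Z : Ω' → E} (h : TendstoInDistribution V atTop Z (fun _ => P) P') :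
    BoundedInProb P V := by
  intro ε hε
  set μ := P'.map Z with hμ
  have : IsProbabilityMeasure μ := Measure.isProbabilityMeasure_map h.aemeasurable_limit
  have hclosed (C : ℝ) : IsClosed {x : E | C ≤ ‖x‖} := isClosed_le continuous_const continuous_norm
  have hlim : Tendsto (fun N : ℕ => μ {x : E | (N : ℝ) ≤ ‖x‖}) atTop (𝓝 0) := by
    have hinter : ⋂ N : ℕ, {x : E | (N : ℝ) ≤ ‖x‖} = ∅ := by
      refine Set.eq_empty_iff_forall_notMem.2 fun x hx => ?_
      obtain ⟨N, hN⟩ := exists_nat_gt ‖x‖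
      exact (Set.mem_iInter.1 hx N).not_gt hN
    have := tendsto_measure_iInter_atTop (μ := μ) (s := fun N : ℕ => {x : E | (N : ℝ) ≤ ‖x‖})
      (fun N => (hclosed N).measurableSet.nullMeasurableSet)
      (fun N N' hNN' x (hx : (N' : ℝ) ≤ ‖x‖) =>
        show (N : ℝ) ≤ ‖x‖ from (Nat.cast_le.2 hNN').trans hx) ⟨0, measure_ne_top _ _⟩
    rwa [hinter, measure_empty] at this
  obtain ⟨N, hN⟩ := (hlim.eventually_lt_const (ENNReal.ofReal_pos.2 hε)).exists
  refine ⟨N, ?_⟩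
  have hsup := ProbabilityMeasure.limsup_measure_closed_le_of_tendsto h.tendsto (hclosed N)
  filter_upwards [eventually_lt_of_limsup_lt (hsup.trans_lt hN)] with n hn
  refine ENNReal.toReal_le_of_le_ofReal hε.le ?_
  refine le_trans (le_of_eq ?_) hn.le
  exact (Measure.map_apply_of_aemeasurable (h.forall_aemeasurable n)
    (hclosed N).measurableSet).symm

lemma tendstoInMeasure_of_eventually_subset {F G : Type*} [PseudoMetricSpace F]
    [PseudoMetricSpace G] {f : ℕ → Ω → F} {g : ℕ → Ω → G} {a : F} {b : G}
    (hg : TendstoInMeasure P g atTop fun _ => b)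
    (h : ∀ ε > 0, ∃ δ > 0, ∀ᶠ n in atTop, ∀ ω, dist (g n ω) b < δ → dist (f n ω) a < ε) :
    TendstoInMeasure P f atTop fun _ => a := by
  rw [tendstoInMeasure_iff_dist] at hg ⊢
  intro ε hε
  obtain ⟨δ, hδ, hev⟩ := h ε hε
  refine tendsto_of_tendsto_of_tendsto_of_le_of_le' tendsto_const_nhds (hg δ hδ)
    (Eventually.of_forall fun _ => zero_le) ?_
  filter_upwards [hev] with n hn
  refine measure_mono fun ω hω => ?_
  by_contra hcon
  exact (hn ω (not_le.1 hcon)).not_ge hω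

lemma tendstoInMeasure_comp_perturbed {A B : ℕ → Ω → E} {p : E} {φ : E → ℝ}
    (hφ : ContinuousAt φ p) (hAB : ∀ n ω, 1 ≤ n → ‖B n ω - A n ω‖ ≤ 1 / ((n : ℝ) + 1))
    (hA : TendstoInMeasure P A atTop fun _ => p) :
    TendstoInMeasure P (fun n ω => φ (B n ω)) atTop fun _ => φ p := by
  refine tendstoInMeasure_of_eventually_subset hA fun ε hε => ?_
  obtain ⟨δ, hδ, hball⟩ := Metric.continuousAt_iff.1 hφ ε hε
  refine ⟨δ / 2, half_pos hδ, ?_⟩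
  have hev : ∀ᶠ n : ℕ in atTop, 1 / ((n : ℝ) + 1) < δ / 2 :=
    tendsto_one_div_add_atTop_nhds_zero_nat.eventually_lt_const (half_pos hδ)
  filter_upwards [hev, eventually_ge_atTop 1] with n hn hn1 ω hω
  refine hball ?_
  calc dist (B n ω) p ≤ dist (B n ω) (A n ω) + dist (A n ω) p := dist_triangle _ _ _
    _ < δ / 2 + δ / 2 := by
        refine add_lt_add ?_ hω
        rw [dist_eq_norm]
        exact (hAB n ω hn1).trans_lt hn
    _ = δ := add_halves δ

lemma tendsto_inv_sqrt_nat : Tendsto (fun n : ℕ => (√(n : ℝ))⁻¹) atTop (𝓝 0) :=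
  tendsto_inv_atTop_zero.comp (Real.tendsto_sqrt_atTop.comp tendsto_natCast_atTop_atTop)

lemma sqrt_mul_one_div_succ_le {n : ℕ} (hn : 1 ≤ n) :
    √(n : ℝ) * (1 / ((n : ℝ) + 1)) ≤ (√(n : ℝ))⁻¹ := by
  have hpos : 0 < √(n : ℝ) := Real.sqrt_pos.2 (Nat.cast_pos.2 hn)
  have hsq : √(n : ℝ) * √(n : ℝ) = n := Real.mul_self_sqrt (Nat.cast_nonneg n)
  rw [mul_one_div, div_le_iff₀ (by positivity), inv_mul_eq_div, le_div_iff₀ hpos, hsq]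
  linarith

/-- The delta method for the perturbation `B` of a sequence `A`. -/
lemma delta_method_perturbed [NormedSpace ℝ E] [IsProbabilityMeasure P] {A B : ℕ → Ω → E} {p : E}
    {φ : E → ℝ} {D : E →L[ℝ] ℝ} (hφ : HasFDerivAt φ D p)
    (hAB : ∀ n ω, 1 ≤ n → ‖B n ω - A n ω‖ ≤ 1 / ((n : ℝ) + 1))
    (hV : BoundedInProb P fun n ω => √(n : ℝ) • (A n ω - p)) :
    TendstoInMeasure P
      (fun (n : ℕ) ω => √(n : ℝ) * (φ (B n ω) - φ p) - D (√(n : ℝ) • (A n ω - p))) atTop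
      fun _ => 0 := by
  rw [tendstoInMeasure_iff_measureReal_norm]
  intro ε hε
  rw [Metric.tendsto_nhds]
  intro η hη
  obtain ⟨C₀, hC₀⟩ := hV (η / 2) (half_pos hη)
  set C := max C₀ 0 with hC
  have hCnn : 0 ≤ C := le_max_right _ _
  -- Chosen so that the differentiability remainder, at most `c * (C + 1)` after scaling, is `ε /
  -- 2`; the other half absorbs the perturbation.
  set c := ε / (2 * (C + 1)) with hc
  have hcpos : 0 < c := by positivity
  obtain ⟨δ, hδ, hball⟩ := Metric.eventually_nhds_iff.1 (hφ.isLittleO.def hcpos)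
  have hinv := tendsto_inv_sqrt_nat
  have hev1 : ∀ᶠ n : ℕ in atTop, (C + 1) * (√(n : ℝ))⁻¹ < δ :=
    (by simpa using hinv.const_mul (C + 1) :
      Tendsto (fun n : ℕ => (C + 1) * (√(n : ℝ))⁻¹) atTop (𝓝 0)).eventually_lt_const hδ
  have hev2 : ∀ᶠ n : ℕ in atTop, ‖D‖ * (√(n : ℝ))⁻¹ < ε / 2 :=
    (by simpa using hinv.const_mul ‖D‖ :
      Tendsto (fun n : ℕ => ‖D‖ * (√(n : ℝ))⁻¹) atTop (𝓝 0)).eventually_lt_const (half_pos hε)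
  filter_upwards [hC₀, hev1, hev2, eventually_ge_atTop 1]
    with n hn1 hn2 hn3 hn
  rw [Real.dist_0_eq_abs, abs_of_nonneg measureReal_nonneg]
  refine lt_of_le_of_lt (le_trans (measureReal_mono fun ω hω => ?_) hn1) (half_lt_self hη)
  by_contra hcon
  rw [Set.mem_ofPred_eq] at hω
  refine absurd hω (not_le.2 ?_)
  have hVC : ‖√(n : ℝ) • (A n ω - p)‖ ≤ C := (not_le.1 hcon).le.trans (le_max_left _ _)
  set q := √(n : ℝ) with hq
  have hqpos : 0 < q := Real.sqrt_pos.2 (Nat.cast_pos.2 hn)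
  have hdiff : q * ‖B n ω - A n ω‖ ≤ q⁻¹ :=
    (mul_le_mul_of_nonneg_left (hAB n ω hn) hqpos.le).trans (sqrt_mul_one_div_succ_le hn)
  have hBp : q * ‖B n ω - p‖ ≤ C + 1 := by
    rw [norm_smul, Real.norm_of_nonneg hqpos.le] at hVC
    have htri := norm_add_le (B n ω - A n ω) (A n ω - p)
    rw [sub_add_sub_cancel] at htri
    have hq1 : q⁻¹ ≤ 1 := inv_le_one_of_one_le₀ (Real.one_le_sqrt.2 (Nat.one_le_cast.2 hn))
    have hmul := mul_le_mul_of_nonneg_left htri hqpos.le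
    rw [mul_add] at hmul
    linarith
  have hnear : dist (B n ω) p < δ := by
    rw [dist_eq_norm]
    refine lt_of_le_of_lt ?_ hn2
    rwa [← div_eq_mul_inv, le_div_iff₀ hqpos, mul_comm]
  have hrem := hball hnear
  -- The expansion is taken at `B`, where `φ` is evaluated; replacing `B` by `A` in the linear term
  -- costs `q * D (B - A)`, of order `1 / √n`.
  have hdecomp : q * (φ (B n ω) - φ p) - D (q • (A n ω - p)) - 0
      = q * (φ (B n ω) - φ p - D (B n ω - p)) + q * D (B n ω - A n ω) := by
    simp only [map_smul, map_sub, smul_eq_mul]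
    ring
  rw [hdecomp]
  calc ‖q * (φ (B n ω) - φ p - D (B n ω - p)) + q * D (B n ω - A n ω)‖
      ≤ q * ‖φ (B n ω) - φ p - D (B n ω - p)‖ + q * ‖D (B n ω - A n ω)‖ := by
        refine (norm_add_le _ _).trans (le_of_eq ?_)
        rw [norm_mul, norm_mul, Real.norm_of_nonneg hqpos.le]
    _ ≤ c * (C + 1) + ‖D‖ * q⁻¹ := by
        refine add_le_add ?_ ?_
        · calc _ ≤ q * (c * ‖B n ω - p‖) := mul_le_mul_of_nonneg_left hrem hqpos.le
            _ = c * (q * ‖B n ω - p‖) := by ring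
            _ ≤ c * (C + 1) := mul_le_mul_of_nonneg_left hBp hcpos.le
        · calc _ ≤ q * (‖D‖ * ‖B n ω - A n ω‖) :=
                mul_le_mul_of_nonneg_left (D.le_opNorm _) hqpos.le
            _ = ‖D‖ * (q * ‖B n ω - A n ω‖) := by ring
            _ ≤ ‖D‖ * q⁻¹ := mul_le_mul_of_nonneg_left hdiff (norm_nonneg _)
    _ < ε / 2 + ε / 2 := by
        refine add_lt_add_of_le_of_lt (le_of_eq ?_) hn3
        rw [hc]
        field_simp
    _ = ε := add_halves ε

end InProbability

/-! ### Empirical and smoothed p.m.f.s. -/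

section Empirical

variable {Ω : Type*} {r s : ℕ} {X : ℕ → Ω → Fin r} {Y : ℕ → Ω → Fin s}

lemma cellCount_nonneg (n : ℕ) (ω : Ω) (i : Fin r) (j : Fin s) : 0 ≤ cellCount X Y n ω i j :=
  Finset.sum_nonneg fun k _ => by split_ifs <;> norm_num

lemma cellCount_le (n : ℕ) (ω : Ω) (i : Fin r) (j : Fin s) : cellCount X Y n ω i j ≤ n := by
  calc cellCount X Y n ω i j ≤ ∑ _k ∈ Finset.range n, (1 : ℝ) :=
        Finset.sum_le_sum fun k _ => by split_ifs <;> norm_num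
    _ = n := by simp

lemma sum_mul_cellCount (c : Fin r × Fin s → ℝ) (n : ℕ) (ω : Ω) :
    ∑ q, c q * cellCount X Y n ω q.1 q.2 = ∑ k ∈ Finset.range n, c (X k ω, Y k ω) := by
  simp only [cellCount, Finset.mul_sum]
  rw [Finset.sum_comm]
  refine Finset.sum_congr rfl fun k _ => ?_
  rw [Finset.sum_eq_single (X k ω, Y k ω)]
  · simp
  · rintro ⟨i, j⟩ - hne
    rw [if_neg, mul_zero]
    rintro ⟨rfl, rfl⟩
    exact hne rfl
  · simp

lemma sum_pHat {n : ℕ} (hn : 1 ≤ n) (ω : Ω) : ∑ i, ∑ j, pHat X Y n ω i j = 1 := by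
  have h := sum_mul_cellCount (X := X) (Y := Y) (fun _ => 1) n ω
  simp only [one_mul, Fintype.sum_prod_type, Finset.sum_const, Finset.card_range,
    nsmul_eq_mul, mul_one] at h
  simp only [pHat, ← Finset.mul_sum, h]
  exact one_div_mul_cancel (Nat.cast_ne_zero.2 (by omega))

lemma norm_pSmooth_sub_pHat_le [NeZero r] [NeZero s] (n : ℕ) (ω : Ω) (hn : 1 ≤ n) :
    ‖pSmooth X Y n ω - pHat X Y n ω‖ ≤ 1 / ((n : ℝ) + 1) := by
  have hn0 : (0 : ℝ) < n := Nat.cast_pos.2 hn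
  refine (pi_norm_le_iff_of_nonneg (by positivity)).2 fun i =>
    (pi_norm_le_iff_of_nonneg (by positivity)).2 fun j => ?_
  set N := cellCount X Y n ω i j with hN
  have h0 : 0 ≤ N / n := div_nonneg (cellCount_nonneg n ω i j) hn0.le
  have h1 : N / n ≤ 1 := (div_le_one hn0).2 (cellCount_le n ω i j)
  have ha0 : 0 ≤ 1 / ((r : ℝ) * s) := by positivity
  have ha1 : 1 / ((r : ℝ) * s) ≤ 1 := by
    have hr : (1 : ℝ) ≤ r := Nat.one_le_cast.2 (NeZero.pos r)
    have hs : (1 : ℝ) ≤ s := Nat.one_le_cast.2 (NeZero.pos s)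
    exact div_le_one_of_le₀ (one_le_mul_of_one_le_of_one_le hr hs) (by positivity)
  -- Smoothing moves the empirical frequency a fraction `1 / (n + 1)` of the way to `1 / (r s)`;
  -- both lie in `[0, 1]`.
  have heq : (pSmooth X Y n ω - pHat X Y n ω) i j
      = 1 / ((n : ℝ) + 1) * (1 / ((r : ℝ) * s) - N / n) := by
    simp only [Pi.sub_apply, pSmooth, pHat, ← hN]
    field_simp
    ring
  rw [heq, norm_mul, Real.norm_of_nonneg (by positivity : (0 : ℝ) ≤ 1 / ((n : ℝ) + 1))]
  refine mul_le_of_le_one_right (by positivity) ?_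
  rw [Real.norm_eq_abs, abs_le]
  constructor <;> linarith

/-- No regularity of `f` is needed: the value depends on the first `n` observations only, and these
range over a finite set. So measurability of the copula map never has to be established. -/
lemma measurable_pSmooth_comp [MeasurableSpace Ω] {F : Type*} [MeasurableSpace F]
    (hX : ∀ k, Measurable (X k)) (hY : ∀ k, Measurable (Y k)) (f : Table r s → F) (n : ℕ) :
    Measurable fun ω => f (pSmooth X Y n ω) := by
  let g : (Fin n → Fin r × Fin s) → F := fun w => f fun i j =>
    1 / ((n : ℝ) + 1) * ((∑ k : Fin n, if (w k).1 = i ∧ (w k).2 = j then 1 else 0)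
      + 1 / ((r : ℝ) * (s : ℝ)))
  have hg : Measurable g := measurable_of_countable g
  have hw : Measurable fun ω (k : Fin n) => (X k ω, Y k ω) :=
    measurable_pi_lambda _ fun k => (hX k).prodMk (hY k)
  have heq : (fun ω => f (pSmooth X Y n ω)) = g ∘ fun ω (k : Fin n) => (X k ω, Y k ω) := by
    funext ω
    refine congrArg f (funext fun i => funext fun j => ?_)
    simp only [pSmooth, cellCount, Finset.sum_range]
  rw [heq]
  exact hg.comp hw

end Empirical

/-! ### The central limit theorem for the empirical p.m.f. -/

section CentralLimit

variable {Ω : Type*} [MeasurableSpace Ω] {P : Measure Ω} [IsProbabilityMeasure P] {r s : ℕ}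
  {X : ℕ → Ω → Fin r} {Y : ℕ → Ω → Fin s} {p : Table r s}

lemma integral_cell (hX : ∀ k, Measurable (X k)) (hY : ∀ k, Measurable (Y k))
    (hlaw : ∀ k i j, P.real {ω | X k ω = i ∧ Y k ω = j} = p i j) (k : ℕ)
    (c : Fin r × Fin s → ℝ) : ∫ ω, c (X k ω, Y k ω) ∂P = c ⬝ᵥ vec p := by
  have hm : Measurable fun ω => (X k ω, Y k ω) := (hX k).prodMk (hY k)
  have hc : Measurable c := measurable_of_countable c
  have : IsProbabilityMeasure (P.map fun ω => (X k ω, Y k ω)) :=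
    Measure.isProbabilityMeasure_map hm.aemeasurable
  rw [← integral_map (φ := fun ω => (X k ω, Y k ω)) hm.aemeasurable hc.aestronglyMeasurable,
    integral_fintype .of_finite]
  refine Finset.sum_congr rfl fun q _ => ?_
  rw [map_measureReal_apply hm (measurableSet_singleton q), smul_eq_mul, mul_comm, vec,
    ← hlaw k q.1 q.2]
  congr 2
  ext ω
  simp [Prod.ext_iff]

lemma identDistrib_cell (hX : ∀ k, Measurable (X k)) (hY : ∀ k, Measurable (Y k))
    (hlaw : ∀ k i j, P.real {ω | X k ω = i ∧ Y k ω = j} = p i j) (k : ℕ) :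
    IdentDistrib (fun ω => (X k ω, Y k ω)) (fun ω => (X 0 ω, Y 0 ω)) P P := by
  have hm (k : ℕ) : Measurable fun ω => (X k ω, Y k ω) := (hX k).prodMk (hY k)
  refine ⟨(hm k).aemeasurable, (hm 0).aemeasurable, Measure.ext_of_singleton fun q => ?_⟩
  have hpre (k : ℕ) : (fun ω => (X k ω, Y k ω)) ⁻¹' {q} = {ω | X k ω = q.1 ∧ Y k ω = q.2} := by
    ext ω
    simp [Prod.ext_iff]
  rw [Measure.map_apply (hm k) (measurableSet_singleton q),
    Measure.map_apply (hm 0) (measurableSet_singleton q), hpre, hpre,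
    ← ENNReal.toReal_eq_toReal_iff' (measure_ne_top _ _) (measure_ne_top _ _)]
  exact (hlaw k q.1 q.2).trans (hlaw 0 q.1 q.2).symm

lemma dotProduct_covMat (c : Fin r × Fin s → ℝ) (p : Table r s) :
    c ⬝ᵥ (covMat p).mulVec c = (fun q => c q ^ 2) ⬝ᵥ vec p - (c ⬝ᵥ vec p) ^ 2 := by
  rw [covMat, Matrix.sub_mulVec, dotProduct_sub, Matrix.vecMulVec_mulVec]
  congr 1
  · simp only [dotProduct, Matrix.mulVec_diagonal]
    exact Finset.sum_congr rfl fun q _ => by ring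
  · simp [dotProduct_smul, dotProduct_comm (vec p) c, sq]

/-- The central limit theorem for linear functionals of the empirical p.m.f. -/
lemma tendstoInDistribution_dotProduct_pHat (hX : ∀ k, Measurable (X k))
    (hY : ∀ k, Measurable (Y k)) (hindep : iIndepFun (fun k ω => (X k ω, Y k ω)) P)
    (hlaw : ∀ k i j, P.real {ω | X k ω = i ∧ Y k ω = j} = p i j) (c : Fin r × Fin s → ℝ) :
    ∃ v : NNReal, (v : ℝ) = c ⬝ᵥ (covMat p).mulVec c ∧
      TendstoInDistribution (fun (n : ℕ) ω => c ⬝ᵥ vec (√(n : ℝ) • (pHat X Y n ω - p))) atTop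
        (id : ℝ → ℝ) (fun _ => P) (gaussianReal 0 v) := by
  have hc : Measurable c := measurable_of_countable c
  set W : ℕ → Ω → ℝ := fun k ω => c (X k ω, Y k ω) with hW
  have hmem : MemLp (W 0) 2 P := by
    refine MemLp.of_bound (hc.comp ((hX 0).prodMk (hY 0))).aestronglyMeasurable ‖c‖
      (Eventually.of_forall fun ω => norm_le_pi_norm c _)
  have hmean : P[W 0] = c ⬝ᵥ vec p := integral_cell hX hY hlaw 0 c
  have hvar : Var[W 0; P] = c ⬝ᵥ (covMat p).mulVec c := by
    rw [variance_eq_sub hmem, hmean, dotProduct_covMat]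
    congr 1
    exact integral_cell hX hY hlaw 0 fun q => c q ^ 2
  have hclt := tendstoInDistribution_inv_sqrt_mul_sum_sub (P := P) (X := W) (Y := (id : ℝ → ℝ))
    (P' := gaussianReal 0 Var[W 0; P].toNNReal) ⟨aemeasurable_id, Measure.map_id⟩ hmem
    (hindep.comp (fun _ => c) fun _ => hc)
    fun k => (identDistrib_cell hX hY hlaw k).comp hc
  refine ⟨Var[W 0; P].toNNReal, ?_, ?_⟩
  · rw [Real.coe_toNNReal _ (variance_nonneg _ _), hvar]
  · convert! hclt using 3 with n ω
    -- At `n = 0` both sides vanish, through `√0 = 0` on one side and the empty sum on the other.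
    rcases Nat.eq_zero_or_pos n with rfl | hn
    · simp [dotProduct, vec]
    have hn0 : (0 : ℝ) < n := Nat.cast_pos.2 hn
    have hq : √(n : ℝ) ≠ 0 := (Real.sqrt_pos.2 hn0).ne'
    have hsq : √(n : ℝ) * √(n : ℝ) = n := Real.mul_self_sqrt hn0.le
    have h1 : c ⬝ᵥ vec (√(n : ℝ) • (pHat X Y n ω - p))
        = √(n : ℝ) * (1 / n * ∑ q, c q * cellCount X Y n ω q.1 q.2 - c ⬝ᵥ vec p) := by
      simp only [dotProduct, vec, Pi.smul_apply, Pi.sub_apply, smul_eq_mul, pHat,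
        Finset.mul_sum, ← Finset.sum_sub_distrib]
      exact Finset.sum_congr rfl fun q _ => by ring
    rw [h1, sum_mul_cellCount, hmean]
    field_simp
    rw [sq, hsq]

/-- The scalar central limit theorem bounds each cell in probability, and a union bound over the
finitely many cells replaces a multivariate limit theorem. -/
lemma boundedInProb_pHat (hX : ∀ k, Measurable (X k)) (hY : ∀ k, Measurable (Y k))
    (hindep : iIndepFun (fun k ω => (X k ω, Y k ω)) P)
    (hlaw : ∀ k i j, P.real {ω | X k ω = i ∧ Y k ω = j} = p i j) :
    BoundedInProb P fun n ω => √(n : ℝ) • (pHat X Y n ω - p) := by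
  intro ε hε
  have hcell (q : Fin r × Fin s) : ∃ C : ℝ, ∀ᶠ n : ℕ in atTop,
      P.real {ω | C ≤ ‖vec (√(n : ℝ) • (pHat X Y n ω - p)) q‖} ≤ ε / ((r * s : ℕ) + 1) := by
    obtain ⟨v, -, hv⟩ := tendstoInDistribution_dotProduct_pHat hX hY hindep hlaw (Pi.single q 1)
    simp only [single_one_dotProduct] at hv
    exact BoundedInProb.of_tendstoInDistribution hv _ (by positivity)
  choose C hC using hcell
  set C₁ := ∑ q, |C q| + 1 with hC₁
  have hle (q : Fin r × Fin s) : C q < C₁ :=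
    ((le_abs_self _).trans (Finset.single_le_sum (f := fun q => |C q|)
      (fun _ _ => abs_nonneg _) (Finset.mem_univ q))).trans_lt (lt_add_one _)
  have hC₁pos : 0 < C₁ := by positivity
  refine ⟨C₁, ?_⟩
  filter_upwards [eventually_all.2 hC] with n hn
  calc P.real {ω | C₁ ≤ ‖√(n : ℝ) • (pHat X Y n ω - p)‖}
      ≤ P.real (⋃ q, {ω | C q ≤ ‖vec (√(n : ℝ) • (pHat X Y n ω - p)) q‖}) := by
        refine measureReal_mono fun ω hω => ?_
        by_contra hcon
        simp only [Set.mem_iUnion, Set.mem_ofPred_eq, not_exists, not_le] at hcon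
        refine (not_le.2 ?_ : ¬ C₁ ≤ ‖√(n : ℝ) • (pHat X Y n ω - p)‖) hω
        refine (pi_norm_lt_iff hC₁pos).2 fun i => (pi_norm_lt_iff hC₁pos).2 fun j => ?_
        exact (hcon (i, j)).trans (hle _)
    _ ≤ ∑ q, P.real {ω | C q ≤ ‖vec (√(n : ℝ) • (pHat X Y n ω - p)) q‖} :=
        measureReal_iUnion_fintype_le _
    _ ≤ ∑ _q : Fin r × Fin s, ε / ((r * s : ℕ) + 1) := Finset.sum_le_sum fun q _ => hn q
    _ ≤ ε := by
        rw [Finset.sum_const, Finset.card_univ, Fintype.card_prod, Fintype.card_fin,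
          Fintype.card_fin, nsmul_eq_mul, mul_div_assoc', div_le_iff₀ (by positivity)]
        nlinarith

end CentralLimit

/-! ### Limit theorems for plug-in estimators. -/

section PlugIn

variable {Ω : Type*} [MeasurableSpace Ω] {P : Measure Ω} [IsProbabilityMeasure P] {r s : ℕ}
  [NeZero r] [NeZero s] {X : ℕ → Ω → Fin r} {Y : ℕ → Ω → Fin s} {p : Table r s}
  {η : Table r s → ℝ}

lemma hasFDerivAt_plugIn (hpos : ∀ i j, 0 < p i j) (hη : DifferentiableAt ℝ η (copula p)) :
    HasFDerivAt (fun x => η (copula x))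
      ((fderiv ℝ η (copula p)).comp (copulaDeriv (copula p) p)) p :=
  hη.hasFDerivAt.comp p (hasFDerivAt_copula hpos)

omit [IsProbabilityMeasure P] in
lemma consistent_of_differentiableAt (hpos : ∀ i j, 0 < p i j)
    (hη : DifferentiableAt ℝ η (copula p))
    (h : TendstoInMeasure P (pHat X Y) atTop fun _ => p) : Consistent P X Y p η :=
  tendstoInMeasure_comp_perturbed (φ := fun x => η (copula x)) (hasFDerivAt_plugIn hpos hη).continuousAt
    norm_pSmooth_sub_pHat_le h

omit [MeasurableSpace Ω] [NeZero r] [NeZero s] in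
-- Places the empirical fluctuation among the directions in which `J_{u,p}` is the derivative. For
-- `n = 0` the empirical table is not a p.m.f., but the factor `√0` vanishes.
lemma sum_sqrt_smul_pHat_sub (hp1 : ∑ i, ∑ j, p i j = 1) (n : ℕ) (ω : Ω) :
    ∑ i, ∑ j, (√(n : ℝ) • (pHat X Y n ω - p)) i j = 0 := by
  rcases Nat.eq_zero_or_pos n with rfl | hn
  · simp
  · simp only [Pi.smul_apply, Pi.sub_apply, smul_eq_mul, ← Finset.mul_sum,
      Finset.sum_sub_distrib, sum_pHat hn, hp1, sub_self, mul_zero]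

lemma asympLinear_of_differentiableAt (hpos : ∀ i j, 0 < p i j) (hp1 : ∑ i, ∑ j, p i j = 1)
    (hη : DifferentiableAt ℝ η (copula p))
    (hV : BoundedInProb P fun n ω => √(n : ℝ) • (pHat X Y n ω - p)) :
    AsympLinear P X Y p η := by
  have h := delta_method_perturbed (φ := fun x => η (copula x)) (hasFDerivAt_plugIn hpos hη) norm_pSmooth_sub_pHat_le hV
  refine h.congr_left fun n => Eventually.of_forall fun ω => ?_
  have e : √(n : ℝ) • vec (pHat X Y n ω - p) = vec (√(n : ℝ) • (pHat X Y n ω - p)) := rfl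
  simp only [uHat]
  rw [e, matJ_mulVec hp1 (sum_sqrt_smul_pHat_sub hp1 n ω), ← fderiv_eq_grad_dotProduct hη]
  rfl

lemma asympVar_eq (p : Table r s) (η : Table r s → ℝ) :
    asympVar p η = Matrix.vecMul (grad η (copula p)) (matJ (copula p) p) ⬝ᵥ
      (covMat p).mulVec (Matrix.vecMul (grad η (copula p)) (matJ (copula p) p)) := by
  rw [asympVar, ← Matrix.mulVec_mulVec, ← Matrix.mulVec_mulVec, Matrix.mulVec_transpose,
    Matrix.dotProduct_mulVec]

/-- Slutsky's argument: by asymptotic linearity the estimator differs by `o_P(1)` from the linear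
functional with coefficients `J_{u,p}ᵀ ∇η(u)`, to which the scalar central limit theorem applies. -/
lemma asympNormal_of_differentiableAt (hX : ∀ k, Measurable (X k)) (hY : ∀ k, Measurable (Y k))
    (hindep : iIndepFun (fun k ω => (X k ω, Y k ω)) P)
    (hlaw : ∀ k i j, P.real {ω | X k ω = i ∧ Y k ω = j} = p i j)
    (hpos : ∀ i j, 0 < p i j) (hp1 : ∑ i, ∑ j, p i j = 1)
    (hη : DifferentiableAt ℝ η (copula p)) : AsympNormal P X Y p η := by
  obtain ⟨v, hv, hlim⟩ := tendstoInDistribution_dotProduct_pHat hX hY hindep hlaw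
    (Matrix.vecMul (grad η (copula p)) (matJ (copula p) p))
  refine ⟨v, hv.trans (asympVar_eq p η).symm, ?_⟩
  refine tendstoInDistribution_of_tendstoInMeasure_sub _ _ hlim ?_ fun n => ?_
  · refine (asympLinear_of_differentiableAt hpos hp1 hη
      (boundedInProb_pHat hX hY hindep hlaw)).congr_left fun n => Eventually.of_forall fun ω => ?_
    rw [Matrix.dotProduct_mulVec]
    rfl
  · exact (((measurable_pSmooth_comp hX hY (fun x => η (copula x)) n).sub_const _).const_mul
      _).aemeasurable

end PlugIn

end CopulaPmf

theorem corollary3p3 {Ω : Type*} [MeasurableSpace Ω] (P : Measure Ω) [IsProbabilityMeasure P]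
    {r s : ℕ} [NeZero r] [NeZero s] (hr : 2 ≤ r) (hs : 2 ≤ s)
    (p : CopulaPmf.Table r s) (hp : p ∈ CopulaPmf.Gamma r s)
    (hsupp : CopulaPmf.supp p = Set.univ)
    (X : ℕ → Ω → Fin r) (Y : ℕ → Ω → Fin s)
    (hX : ∀ k, Measurable (X k)) (hY : ∀ k, Measurable (Y k)) :
    -- consistency
    (TendstoInMeasure P (CopulaPmf.pHat X Y) atTop (fun _ => p) →
      (CopulaPmf.Consistent P X Y p CopulaPmf.yule ∧
        CopulaPmf.Consistent P X Y p CopulaPmf.gkGamma ∧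
        CopulaPmf.Consistent P X Y p CopulaPmf.tauB) ∧
      -- asymptotic linearity, if additionally the empirical p.m.f. has a limiting distribution
      ∀ {Ω' : Type*} [MeasurableSpace Ω'] (P' : Measure Ω') [IsProbabilityMeasure P']
        (Z : Ω' → CopulaPmf.Table r s),
        TendstoInDistribution (fun (n : ℕ) ω => √(n : ℝ) • (CopulaPmf.pHat X Y n ω - p)) atTop
          Z (fun _ => P) P' →
        CopulaPmf.AsympLinear P X Y p CopulaPmf.yule ∧
          CopulaPmf.AsympLinear P X Y p CopulaPmf.gkGamma ∧
          CopulaPmf.AsympLinear P X Y p CopulaPmf.tauB) ∧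
    -- asymptotic normality under i.i.d. sampling from `p`
    (iIndepFun (fun k ω => (X k ω, Y k ω)) P →
      (∀ k i j, P.real {ω | X k ω = i ∧ Y k ω = j} = p i j) →
      CopulaPmf.AsympNormal P X Y p CopulaPmf.yule ∧
        CopulaPmf.AsympNormal P X Y p CopulaPmf.gkGamma ∧
        CopulaPmf.AsympNormal P X Y p CopulaPmf.tauB) := by
  have hpos : ∀ i j, 0 < p i j := fun i j => by
    have h : (i, j) ∈ CopulaPmf.supp p := hsupp ▸ Set.mem_univ _
    exact h
  have hp1 : ∑ i, ∑ j, p i j = 1 := hp.2.2.2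
  have hu := (CopulaPmf.isCopulaOf_copula hpos).pos
  have hρ := CopulaPmf.differentiable_yule (CopulaPmf.copula p)
  have hγ := CopulaPmf.differentiableAt_gkGamma hr hs hu
  have hτ := CopulaPmf.differentiableAt_tauB hr hs hu
  refine ⟨fun hcons => ⟨⟨CopulaPmf.consistent_of_differentiableAt hpos hρ hcons,
    CopulaPmf.consistent_of_differentiableAt hpos hγ hcons,
    CopulaPmf.consistent_of_differentiableAt hpos hτ hcons⟩, ?_⟩, fun hindep hlaw =>
    ⟨CopulaPmf.asympNormal_of_differentiableAt hX hY hindep hlaw hpos hp1 hρ,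
      CopulaPmf.asympNormal_of_differentiableAt hX hY hindep hlaw hpos hp1 hγ,
      CopulaPmf.asympNormal_of_differentiableAt hX hY hindep hlaw hpos hp1 hτ⟩⟩
  intro Ω' _ P' _ Z hZ
  -- The limit law enters only through stochastic boundedness.
  have hV := CopulaPmf.BoundedInProb.of_tendstoInDistribution hZ
  exact ⟨CopulaPmf.asympLinear_of_differentiableAt hpos hp1 hρ hV,
    CopulaPmf.asympLinear_of_differentiableAt hpos hp1 hγ hV,
    CopulaPmf.asympLinear_of_differentiableAt hpos hp1 hτ hV⟩
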